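/- **Model.** There are $n$ processes with inputs $x_1,\dots,x_n\in\{0,\dots,k\}$. In the non-uniform iterated snapshot (NIS) model there is an infinite sequence $S_1,S_2,\dots$ of snapshot objects with $n$ components each, all initially empty. The initial state of process $i$ is $(i,x_i)$. Each process accesses $S_1,S_2,\dots$ in order: it first performs an update, which sets the $i$-th component of $S_r$ to its current state (its new state is the old one with an extra bit), and at its next step it performs a scan of $S_r$, after which its state consists of $i$ and the result of the scan. After each scan it applies the decision map $\delta:\{\text{states}\}\to\{0,\dots,k\}\cup\{\bot\}$ to its state; if the value is not $\bot$, the process outputs it and terminates, otherwise it continues with $S_{r+1}$. A protocol is given by $\delta$. A process is active if it has not terminated, and a configuration is final if no process is active in it. A schedule from a configuration $C$ is a sequence of processes each of which is active when it takes its step; $C\alpha$ is the configuration reached by the finite schedule $\alpha$. A configuration is correct for $k$-set agreement if every output is the input of some process (validity) and at most $k$ different values have been output (agreement). **Extension-based proofs.** A prover interacts with a protocol in phases $\varphi=1,2,\dots$. Phase $\varphi$ starts with a finite schedule $\alpha(\varphi)$ from a set $B(\varphi)$ of initial configurations; put $A(\varphi)=\{C_0\alpha(\varphi): C_0\in B(\varphi)\}$,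 and let $A'(\varphi)$ be the set of configurations reached so far in the phase, initially empty. In phase 1, $\alpha(1)$ is empty and $B(1)$ is the set of all initial configurations. If every configuration in $A(\varphi)$ is final and correct, the prover loses. The prover, whose moves may depend on all earlier moves and replies, makes moves of the following kinds. * A query $(C,q)$ with $C\in A(\varphi)\cup A'(\varphi)$ and $q$ active in $C$. The reply is the configuration $Cq$, including the output of $q$ in it, if any; $Cq$ is added to $A'(\varphi)$. If $Cq$ is not correct, the prover wins. * An output query $(C,Q,y)$ with $C\in A(\varphi)\cup A'(\varphi)$, $Q$ a set of processes active in $C$, and $y\in\{0,\dots,k\}$. The reply is some schedule from $C$, containing only processes in $Q$, after which some process in $Q$ has output $y$, or NONE if no such schedule exists. * Ending the phase, by committing to a nonempty schedule $\alpha'$ from some $C=C_0'\alpha(\varphi)\in A(\varphi)$, $C_0'\in B(\varphi)$, with $C\alpha'\in A'(\varphi)$. Then $\alpha(\varphi+1)=\alpha(\varphi)\alpha'$, and $B(\varphi+1)$ is the set of all initial configurations that differ from $C_0'$ only in the inputs of processes not occurring in $\alpha(\varphi+1)$. A chain of queries is a sequence of queries $(C_1,q_1),(C_2,q_2),\dots$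 with $C_{i+1}=C_iq_i$. The prover must end each phase after finitely many output queries and finitely many chains of queries (which may be interleaved). It wins if, within these rules, the interaction is infinite, i.e. if there are infinitely many phases or a chain of queries continues forever. An extension-based proof that deterministic wait-free $k$-set agreement among $n$ processes is impossible in the NIS model is a prover that wins against every protocol (for every choice of the schedules returned in answer to output queries). **Theorem.** Let $n>k\ge 2$. There is no extension-based proof that deterministic wait-free $k$-set agreement among $n$ processes is impossible in the NIS model. Moreover, there is an adversary that answers the moves one by one as they are made, holding at every time a protocol that it may revise but that agrees with all the replies given so far, such that, as long as the moves are legal: 1. in phase 1, no configuration reached by the prover violates agreement or validity; 2. in phase 1, every chain of queries is finite: the prover cannot continue phase 1 forever with finitely many output queries and finitely many chains of queries; 3. from the beginning of phase 2 on, the protocol is never changed again, there is no infinite schedule from any configuration in $A(\varphi)$, $\varphi\ge 2$, and every configuration reached by a finite schedule from a configuration in $A(\varphi)$ is correct; 4. every prover that obeys the rules loses against this adversary, after finitely many moves. -/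

import Mathlib

noncomputable section

namespace NIS

/-! ### The non-uniform iterated snapshot model

Processes are `Fin n`; inputs and outputs are the values `0, …, k`, i.e. `Fin (k + 1)`. -/

/-- The possible states of a process: its initial state (identifier and input); a state `s`
together with the extra bit saying that `update(s)` has just been performed; or the identifier
together with the result of a `scan` (where `none` is the initial value of a component). -/
inductive State (n k : ℕ) : Type
  | init (i : Fin n) (x : Fin (k + 1)) : State n k
  | updated (s : State n k) : State n k
  | scanned (i : Fin n) (view : Fin n → Option (State n k)) : State n k

/-- A decision map `δ`; `none` stands for `⊥`. -/
abbrev DecisionMap (n k : ℕ) : Type := State n k → Option (Fin (k + 1))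

/-- A configuration: the states of the processes and the contents of all snapshot objects
`S 0, S 1, …`. The inputs and, for each process, the index of the snapshot object that it is
currently due to access are recorded as well; in a reachable configuration both are
determined by the states. -/
@[ext]
structure Config (n k : ℕ) : Type where
  input : Fin n → Fin (k + 1)
  state : Fin n → State n k
  round : Fin n → ℕ
  mem : ℕ → Fin n → Option (State n k)

variable {n k : ℕ}

/-- The initial configuration with inputs `x`. -/
def Config.initial (x : Fin n → Fin (k + 1)) : Config n k where
  input := x
  state := fun i => State.init i (x i)
  round := fun _ => 0
  mem := fun _ _ => none

/-- The output of a process in a given state. The map `δ` is consulted only after a `scan`. -/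
def State.output (δ : DecisionMap n k) : State n k → Option (Fin (k + 1))
  | .init _ _ => none
  | .updated _ => none
  | .scanned i view => δ (.scanned i view)

/-- The value that process `i` has output in configuration `C` (`none` if there is none). -/
def Config.output (δ : DecisionMap n k) (C : Config n k) (i : Fin n) : Option (Fin (k + 1)) :=
  (C.state i).output δ

/-- A process is active if it has not terminated, i.e. has not output a value. -/
def Config.Active (δ : DecisionMap n k) (C : Config n k) (i : Fin n) : Prop :=
  C.output δ i = none

/-- A configuration is final if it has no active processes. -/
def Config.Final (δ : DecisionMap n k) (C : Config n k) : Prop :=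
  ∀ i, ¬ C.Active δ i

/-- The configuration `C q` obtained when `q` takes its next step: a `scan` of the current
snapshot object if `q` has just updated it, and otherwise an `update` of it. -/
def Config.step (C : Config n k) (q : Fin n) : Config n k :=
  match C.state q with
  | .updated _ =>
    { input := C.input
      state := Function.update C.state q (.scanned q (C.mem (C.round q)))
      round := Function.update C.round q (C.round q + 1)
      mem := C.mem }
  | s =>
    { input := C.input
      state := Function.update C.state q (.updated s)
      round := C.round
      mem := Function.update C.mem (C.round q)
        (Function.update (C.mem (C.round q)) q (some s)) }

/-- The configuration `C β` reached from `C` by the finite sequence of steps `β`. -/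
def Config.run (C : Config n k) (β : List (Fin n)) : Config n k :=
  β.foldl Config.step C

/-- `β` is a (finite) schedule from `C`: every process in it is active when it takes its step. -/
def IsSchedule (δ : DecisionMap n k) : Config n k → List (Fin n) → Prop
  | _, [] => True
  | C, q :: β => C.Active δ q ∧ IsSchedule δ (C.step q) β

/-- The infinite sequence of processes `f` is a schedule from `C`. -/
def IsInfiniteSchedule (δ : DecisionMap n k) (C : Config n k) (f : ℕ → Fin n) : Prop :=
  ∀ t, IsSchedule δ C (List.ofFn fun i : Fin t => f i)

/-- The values output in `C` satisfy the specification of `k`-set agreement: every output is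
the input of some process (validity), and at most `k` different values are output
(agreement). -/
def Config.Correct (δ : DecisionMap n k) (C : Config n k) : Prop :=
  (∀ i y, C.output δ i = some y → ∃ j, C.input j = y) ∧
    {y | ∃ i, C.output δ i = some y}.ncard ≤ k

/-- From `C` the protocol is wait-free and never violates agreement or validity. -/
def TerminatesCorrectly (δ : DecisionMap n k) (C : Config n k) : Prop :=
  (∀ f, ¬ IsInfiniteSchedule δ C f) ∧ ∀ β, IsSchedule δ C β → (C.run β).Correct δ

/-- The schedule `β` witnesses a positive answer to the output query `(C, Q, y)`: it is a
`Q`-only schedule from `C` after which some process in `Q` has output `y`. -/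
def IsOutputWitness (δ : DecisionMap n k) (C : Config n k) (Q : Finset (Fin n))
    (y : Fin (k + 1)) (β : List (Fin n)) : Prop :=
  IsSchedule δ C β ∧ (∀ q ∈ β, q ∈ Q) ∧ ∃ q ∈ Q, (C.run β).output δ q = some y

/-- A protocol, as seen by a prover: a decision map, which determines the behaviour of the
processes, and a choice of the schedules that are returned in answer to output queries
(`none` exactly if no suitable schedule exists). -/
structure Protocol (n k : ℕ) : Type where
  δ : DecisionMap n k
  answer : Config n k → Finset (Fin n) → Fin (k + 1) → Option (List (Fin n))
  answer_some : ∀ C Q y β, answer C Q y = some β → IsOutputWitness δ C Q y β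
  answer_none : ∀ C Q y, answer C Q y = none → ∀ β, ¬ IsOutputWitness δ C Q y β

/-! ### The interaction between a prover and a protocol -/

/-- The moves of a prover: a query `(C, q)`; an output query `(C, Q, y)`; or the end of the
phase, by committing to the schedule `β` from the configuration `C₀ α(φ)`, where `C₀` is the
initial configuration with inputs `x`. -/
inductive Move (n k : ℕ) : Type
  | query (C : Config n k) (q : Fin n) : Move n k
  | output (C : Config n k) (Q : Finset (Fin n)) (y : Fin (k + 1)) : Move n k
  | commit (x : Fin n → Fin (k + 1)) (β : List (Fin n)) : Move n k

/-- The move ends the current phase. -/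
def Move.IsCommit : Move n k → Prop
  | .commit _ _ => True
  | _ => False

/-- The replies: the configuration `C q`, together with the output of `q` in it, if any; the
answer to an output query; or a mere acknowledgement of the end of a phase. -/
inductive Reply (n k : ℕ) : Type
  | reached (C : Config n k) (out : Option (Fin (k + 1))) : Reply n k
  | answer (β : Option (List (Fin n))) : Reply n k
  | ack : Reply n k

/-- The reply of a protocol to a move. -/
def Protocol.reply (R : Protocol n k) : Move n k → Reply n k
  | .query C q => .reached (C.step q) ((C.step q).output R.δ q)
  | .output C Q y => .answer (R.answer C Q y)
  | .commit _ _ => .ack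

/-- The data of the interaction during a phase `φ`: the inputs of the initial configurations in
`B(φ)`, the schedule `α(φ)`, and the set `A'(φ)` of configurations reached in this phase. -/
structure Game (n k : ℕ) : Type where
  inits : Set (Fin n → Fin (k + 1))
  sched : List (Fin n)
  reached : Set (Config n k)

/-- The beginning of phase 1. -/
def Game.start (n k : ℕ) : Game n k where
  inits := Set.univ
  sched := []
  reached := ∅

/-- The set `A(φ) = {C₀ α(φ) | C₀ ∈ B(φ)}`. -/
def Game.base (G : Game n k) : Set (Config n k) :=
  {C | ∃ x ∈ G.inits, C = (Config.initial x).run G.sched}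

/-- The effect of a move. -/
def Game.next (G : Game n k) : Move n k → Game n k
  | .query C q => { G with reached := insert (C.step q) G.reached }
  | .output _ _ _ => G
  | .commit x β =>
    { inits := {x' | ∀ i ∈ G.sched ++ β, x' i = x i}
      sched := G.sched ++ β
      reached := ∅ }

/-- The situation after the given moves. -/
def Game.after (ms : List (Move n k)) : Game n k :=
  ms.foldl Game.next (Game.start n k)

/-- The rules for a single move. -/
def Game.Legal (δ : DecisionMap n k) (G : Game n k) : Move n k → Prop
  | .query C q => C ∈ G.base ∪ G.reached ∧ C.Active δ q
  | .output C Q _ => C ∈ G.base ∪ G.reached ∧ ∀ q ∈ Q, C.Active δ q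
  | .commit x β =>
    x ∈ G.inits ∧ β ≠ [] ∧ IsSchedule δ ((Config.initial x).run G.sched) β ∧
      ((Config.initial x).run G.sched).run β ∈ G.reached

/-- The prover has lost: all configurations in `A(φ)` are final, with correct outputs. -/
def Game.Lost (δ : DecisionMap n k) (G : Game n k) : Prop :=
  ∀ C ∈ G.base, C.Final δ ∧ C.Correct δ

/-- The prover has reached a configuration whose outputs violate agreement or validity. -/
def Game.Violation (δ : DecisionMap n k) (G : Game n k) : Prop :=
  ∃ C ∈ G.reached, ¬ C.Correct δ

/-- From time `T` on, the infinite sequence of moves `m` consists of queries only, and these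
are divided into finitely many (possibly interleaved) chains of queries: `c t` is the chain to
which the query at time `t` belongs, and of any two successive queries `(C, q)` and `(C', q')`
of one chain the second one is about `C' = C q`. -/
def FinitelyManyChainsFrom (T : ℕ) (m : ℕ → Move n k) : Prop :=
  (∀ t, T ≤ t → ∃ C q, m t = .query C q) ∧
    ∃ (N : ℕ) (c : ℕ → Fin N), ∀ t t', T ≤ t → t < t' → c t = c t' →
      (∀ u, t < u → u < t' → c u ≠ c t) →
        ∀ C q C' q', m t = .query C q → m t' = .query C' q' → C' = C.step q

/-- An adversary chooses a protocol adaptively: `adv ms` is the protocol according to which it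
answers the last one of the moves `ms`. -/
abbrev Adversary (n k : ℕ) : Type := List (Move n k) → Protocol n k

/-- The adversary that uses one fixed protocol throughout. -/
def Protocol.toAdversary (R : Protocol n k) : Adversary n k := fun _ => R

/-- All moves in the list `ms`, played against `adv`, obey the rules for single moves. -/
def LegalPlay (adv : Adversary n k) (ms : List (Move n k)) : Prop :=
  ∀ ms' m, (ms' ++ [m]) <+: ms → (Game.after ms').Legal (adv ms').δ m

/-- The protocol chosen at any time gives the same replies to all earlier moves as the replies
that were given before. -/
def Coherent (adv : Adversary n k) : Prop :=
  ∀ ms ms', LegalPlay adv ms → ms' <+: ms → ∀ m ∈ ms', (adv ms).reply m = (adv ms').reply m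

/-- A prover chooses its next move on the basis of its previous moves and the replies. -/
abbrev Prover (n k : ℕ) : Type := List (Move n k × Reply n k) → Move n k

/-- The first `t` moves of the prover `P` against `adv`, with the replies. -/
def transcript (P : Prover n k) (adv : Adversary n k) : ℕ → List (Move n k × Reply n k)
  | 0 => []
  | t + 1 =>
    transcript P adv t ++
      [(P (transcript P adv t),
        (adv ((transcript P adv t).map Prod.fst ++ [P (transcript P adv t)])).reply
          (P (transcript P adv t)))]

section play

variable (P : Prover n k) (adv : Adversary n k)

/-- The move of the prover at time `t = 0, 1, …`. -/
def moveAt (t : ℕ) : Move n k := P (transcript P adv t)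

/-- The decision map of the adversary after the first `t` moves. -/
def deltaAt (t : ℕ) : DecisionMap n k := (adv ((transcript P adv t).map Prod.fst)).δ

/-- The situation after the first `t` moves. -/
def gameAt (t : ℕ) : Game n k := Game.after ((transcript P adv t).map Prod.fst)

def LegalAt (t : ℕ) : Prop := (gameAt P adv t).Legal (deltaAt P adv t) (moveAt P adv t)

def LostAt (t : ℕ) : Prop := (gameAt P adv t).Lost (deltaAt P adv t)

def ViolationAt (t : ℕ) : Prop := (gameAt P adv t).Violation (deltaAt P adv t)

/-- An infinite interaction that the rules allow: there are infinitely many phases, or the last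
phase consists of finitely many output queries and finitely many chains of queries (one of
which is then infinite). -/
def InfiniteByRules : Prop :=
  (∀ T, ∃ t, T ≤ t ∧ (moveAt P adv t).IsCommit) ∨
    ∃ T, FinitelyManyChainsFrom T (moveAt P adv)

/-- The prover wins: it reaches a violation of the specification, or it makes the interaction
go on forever, while obeying the rules. -/
def Wins : Prop :=
  (∃ t, (∀ s < t, LegalAt P adv s ∧ ¬ LostAt P adv s) ∧ ViolationAt P adv t) ∨
    ((∀ t, LegalAt P adv t ∧ ¬ LostAt P adv t) ∧ InfiniteByRules P adv)

/-- The prover loses: without reaching a violation, it gets to a phase `φ` in which all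
configurations in `A(φ)` are final and have correct outputs. -/
def Loses : Prop :=
  ∃ t, (∀ s < t, LegalAt P adv s) ∧ (∀ s ≤ t, ¬ ViolationAt P adv s) ∧ LostAt P adv t

/-- As long as the interaction has not ended, the prover makes legal moves, and it ends each
phase after finitely many output queries and chains of queries. -/
def ObeysRules : Prop :=
  (∀ t, (∀ s ≤ t, ¬ LostAt P adv s ∧ ¬ ViolationAt P adv s) → LegalAt P adv t) ∧
    ((∀ t, ¬ LostAt P adv t ∧ ¬ ViolationAt P adv t) → InfiniteByRules P adv)

end play

/-- There is an extension-based proof that deterministic wait-free `k`-set agreement among `n`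
processes is impossible: a prover that wins against every protocol. -/
def ExtensionBasedProof (n k : ℕ) : Prop :=
  ∃ P : Prover n k, ∀ R : Protocol n k, Wins P R.toAdversary

end NIS

end

/-! Call two states of different processes adjacent if they occur in one reachable configuration. In
phase 1 the prover explores only finitely many levels of this graph, and each further round
subdivides it. A state adjacent to an earlier decided state has seen only states adjacent to that
one (`Adj.of_scanned`). Two adjacent states of equal positive level have seen a common state,
because snapshots of one object are comparable (`Adj.comparable`). So regions with different outputs
move apart when decisions are delayed.

The adversary keeps a decision map that decides after at most `t` scans and satisfies `Inv`: decided
neighbours agree, decided neighbours of a state of level `t` agree, and such a state knows their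
value. This survives an increase of `t` (`Inv.succ`). After two undecided rounds any state that is
reached can be given an output (`Inv.exists_decideAt`): the value decided next to a seen state, or
else the input of the process that moved first. Each such revision terminates a process in its chain
of queries, so finitely many chains cause finitely many of them, and between revisions the levels
are bounded. An output query is answered NONE only if no later stage of the construction has a
witness.

When the prover commits to a schedule whose first process has input `a`, everyone who scans knows
`a`. The map `finish` then decides after `t + 2` scans at the latest, on the value of a decided
neighbour or else on `a`. By the distance property all outputs other than `a` coincide, so there are
at most two values, and `2 ≤ k` suffices (`Inv.correct_finish`). Earlier answers NONE stay right,
because an output of the completed protocol could also be produced at a later stage, by one more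
solo round (`Inv.exists_extends_of_finish`).

To refute a proof in the sense of `ExtensionBasedProof`, the adaptive adversary must be replaced by
one protocol. If the interaction stops, the protocol then in use will do; otherwise a limit along an
ultrafilter gives the same replies (`exists_limit`). -/

noncomputable section

namespace NIS

variable {n k : ℕ}

/-! ### States: number of scans and known inputs -/

/-- The number of scans that a process in the given state has performed. -/
def State.level (s : State n k) : ℕ :=
  -- The recursor of the nested type has a second motive, for `Option`. A scan adds one to the level
  -- of the process's own component; an empty component counts as zero.
  State.rec (motive_1 := fun _ => ℕ) (motive_2 := fun _ => ℕ)
    (fun _ _ => 0) (fun _ r => r) (fun i _ r => r i + 1) 0 (fun _ r => r) s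

@[simp] theorem State.level_init (i : Fin n) (x : Fin (k + 1)) :
    (State.init i x : State n k).level = 0 := rfl

@[simp] theorem State.level_updated (s : State n k) : (State.updated s).level = s.level := rfl

theorem State.level_scanned {i : Fin n} {V : Fin n → Option (State n k)} {w : State n k}
    (h : V i = some w) : (State.scanned i V).level = w.level + 1 := by
  have : (State.scanned i V).level = (State.rec_1 (motive_1 := fun _ => ℕ) (motive_2 := fun _ => ℕ)
    (fun _ _ => 0) (fun _ r => r) (fun i _ r => r i + 1) 0 (fun _ r => r) (V i) : ℕ) + 1 := rfl
  rw [this, h]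
  rfl

/-- The input value `y` is known to a process in the given state. -/
inductive Knows (y : Fin (k + 1)) : State n k → Prop
  | init (i : Fin n) : Knows y (.init i y)
  | scanned {i : Fin n} {V : Fin n → Option (State n k)} {j : Fin n} {s : State n k} :
      V j = some s → Knows y s → Knows y (.scanned i V)

/-- Inclusion of the results of scans. -/
def ViewLE (V W : Fin n → Option (State n k)) : Prop := ∀ j s, V j = some s → W j = some s

theorem State.output_eq_some {δ : DecisionMap n k} {s : State n k} {y : Fin (k + 1)}
    (h : s.output δ = some y) : δ s = some y := by
  cases s <;> simp_all [State.output]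

/-! ### Steps -/

theorem Config.step_updated {C : Config n k} {q : Fin n} {s : State n k}
    (h : C.state q = .updated s) :
    C.step q =
      { input := C.input
        state := Function.update C.state q (.scanned q (C.mem (C.round q)))
        round := Function.update C.round q (C.round q + 1)
        mem := C.mem } := by
  simp [Config.step, h]

theorem Config.step_of_ne_updated {C : Config n k} {q : Fin n}
    (h : ∀ s, C.state q ≠ .updated s) :
    C.step q =
      { input := C.input
        state := Function.update C.state q (.updated (C.state q))
        round := C.round
        mem := Function.update C.mem (C.round q)
          (Function.update (C.mem (C.round q)) q (some (C.state q))) } := by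
  unfold Config.step
  split
  · next s hs => exact absurd hs (h s)
  · rfl

theorem Config.exists_updated_or (C : Config n k) (q : Fin n) :
    (∃ s, C.state q = .updated s) ∨ ∀ s, C.state q ≠ .updated s := by
  by_cases h : ∃ s, C.state q = .updated s
  · exact .inl h
  · exact .inr fun s hs => h ⟨s, hs⟩

@[simp] theorem Config.input_step (C : Config n k) (q : Fin n) : (C.step q).input = C.input := by
  unfold Config.step; split <;> rfl

theorem Config.state_step_of_ne (C : Config n k) {p q : Fin n} (h : p ≠ q) :
    (C.step q).state p = C.state p := by
  unfold Config.step; split <;> simp [h]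

theorem Config.round_le_step (C : Config n k) (p q : Fin n) : C.round p ≤ (C.step q).round p := by
  unfold Config.step; split
  · by_cases h : p = q
    · subst h; simp
    · simp [h]
  · rfl

theorem Config.run_nil (C : Config n k) : C.run [] = C := rfl

theorem Config.run_cons (C : Config n k) (q : Fin n) (β : List (Fin n)) :
    C.run (q :: β) = (C.step q).run β := rfl

theorem Config.run_append (C : Config n k) (β γ : List (Fin n)) :
    C.run (β ++ γ) = (C.run β).run γ := List.foldl_append

@[simp] theorem Config.input_run (C : Config n k) (β : List (Fin n)) :
    (C.run β).input = C.input := by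
  induction β generalizing C with
  | nil => rfl
  | cons q β ih => rw [Config.run_cons, ih, Config.input_step]

theorem Config.round_le_run (C : Config n k) (p : Fin n) (β : List (Fin n)) :
    C.round p ≤ (C.run β).round p := by
  induction β generalizing C with
  | nil => rfl
  | cons q β ih => exact (C.round_le_step p q).trans (ih _)

theorem isSchedule_append {δ : DecisionMap n k} {C : Config n k} {β γ : List (Fin n)} :
    IsSchedule δ C (β ++ γ) ↔ IsSchedule δ C β ∧ IsSchedule δ (C.run β) γ := by
  induction β generalizing C with
  | nil => simp [IsSchedule, Config.run_nil]
  | cons q β ih => simp [IsSchedule, Config.run_cons, ih, and_assoc]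

/-- Schedules of a protocol remain schedules if it decides less often. -/
theorem IsSchedule.of_le {δ δ' : DecisionMap n k} (h : ∀ s y, δ s = some y → δ' s = some y)
    {C : Config n k} {β : List (Fin n)} (hβ : IsSchedule δ' C β) : IsSchedule δ C β := by
  induction β generalizing C with
  | nil => trivial
  | cons q β ih =>
    refine ⟨?_, ih hβ.2⟩
    have h1 := hβ.1
    unfold Config.Active Config.output at h1 ⊢
    cases hs : C.state q with
    | scanned i V =>
      rw [hs] at h1
      simp only [State.output] at h1 ⊢
      by_contra hne
      obtain ⟨y, hy⟩ := Option.ne_none_iff_exists'.1 hne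
      rw [h _ _ hy] at h1
      cases h1
    | _ => rfl

/-- The number of steps that have been taken. -/
def Config.weight (C : Config n k) : ℕ :=
  ∑ p, (2 * C.round p + match C.state p with | .updated _ => 1 | _ => 0)

/-- An update adds the one for the extra bit; a scan removes it and adds two for the round. -/
theorem Config.weight_step (C : Config n k) (q : Fin n) : (C.step q).weight = C.weight + 1 := by
  have h1 : ∀ p ∈ Finset.univ.erase q,
      (2 * (C.step q).round p + match (C.step q).state p with | .updated _ => 1 | _ => 0) =
        2 * C.round p + match C.state p with | .updated _ => 1 | _ => 0 := by
    intro p hp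
    have hp : p ≠ q := Finset.ne_of_mem_erase hp
    rw [C.state_step_of_ne hp]
    congr 2
    unfold Config.step; split <;> simp [hp]
  have h2 : (2 * (C.step q).round q + match (C.step q).state q with | .updated _ => 1 | _ => 0) =
      (2 * C.round q + match C.state q with | .updated _ => 1 | _ => 0) + 1 := by
    rcases C.exists_updated_or q with ⟨s, hs⟩ | h
    · simp only [Config.step_updated hs, Function.update_self, hs]; omega
    · simp only [Config.step_of_ne_updated h, Function.update_self]
  unfold Config.weight
  rw [← Finset.add_sum_erase _ _ (Finset.mem_univ q), h2, Finset.sum_congr rfl h1, add_right_comm,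
    Finset.add_sum_erase _ (fun p => 2 * C.round p + match C.state p with | .updated _ => 1 | _ => 0)
      (Finset.mem_univ q)]

theorem Config.weight_run (C : Config n k) (β : List (Fin n)) :
    (C.run β).weight = C.weight + β.length := by
  induction β generalizing C with
  | nil => rfl
  | cons q β ih => rw [Config.run_cons, ih, Config.weight_step, List.length_cons]; omega

theorem Config.weight_le {C : Config n k} {r : ℕ} (h : ∀ p, C.round p ≤ r) :
    C.weight ≤ n * (2 * r + 1) := by
  unfold Config.weight
  refine (Finset.sum_le_card_nsmul _ _ (2 * r + 1) fun p _ => ?_).trans (by simp)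
  have := h p
  split <;> omega

/-! ### Locality -/

/-- A schedule from an initial configuration depends only on the inputs of its processes. -/
theorem IsSchedule.congr_input {δ : DecisionMap n k} {β : List (Fin n)} {C C' : Config n k}
    (hm : C.mem = C'.mem) (hs : ∀ p ∈ β, C.state p = C'.state p ∧ C.round p = C'.round p)
    (h : IsSchedule δ C β) : IsSchedule δ C' β := by
  induction β generalizing C C' with
  | nil => trivial
  | cons q β ih =>
    obtain ⟨h1, h2⟩ := hs q (by simp)
    refine ⟨?_, ih (C := C.step q) ?_ ?_ h.2⟩
    · have := h.1
      unfold Config.Active Config.output at this ⊢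
      rwa [← h1]
    · rcases C.exists_updated_or q with ⟨s, hs⟩ | hne
      · rw [Config.step_updated hs, Config.step_updated (h1 ▸ hs)]
        exact hm
      · rw [Config.step_of_ne_updated hne, Config.step_of_ne_updated (h1 ▸ hne)]
        simp [h1, h2, hm]
    · intro p hp
      obtain ⟨h3, h4⟩ := hs p (by simp [hp])
      rcases C.exists_updated_or q with ⟨s, hs⟩ | hne
      · rw [Config.step_updated hs, Config.step_updated (h1 ▸ hs)]
        by_cases hpq : p = q
        · subst hpq; simp [h2, hm]
        · simp [hpq, h3, h4]
      · rw [Config.step_of_ne_updated hne, Config.step_of_ne_updated (h1 ▸ hne)]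
        by_cases hpq : p = q
        · subst hpq; simp [h1, h2]
        · simp [hpq, h3, h4]

/-! ### Reachable configurations -/

/-- In `C`, process `p` is or was in the state `s`, before its next update. -/
def Occ (C : Config n k) (p : Fin n) (s : State n k) : Prop :=
  (∃ r, C.mem r p = some s) ∨ C.state p = s ∧ ∀ s', s ≠ .updated s'

/-- `C` is reachable from an initial configuration. -/
def Reach (δ : DecisionMap n k) (C : Config n k) : Prop :=
  ∃ x β, IsSchedule δ (Config.initial x) β ∧ C = (Config.initial x).run β

/-- Basic properties of reachable configurations. -/
structure Good (δ : DecisionMap n k) (C : Config n k) : Prop where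
  level_state : ∀ p, (C.state p).level = C.round p
  mem_some : ∀ r p s, C.mem r p = some s → s.level = r ∧ s.output δ = none ∧
    (r < C.round p ∨ r = C.round p ∧ C.state p = .updated s)
  mem_of_updated : ∀ p s, C.state p = .updated s → C.mem (C.round p) p = some s
  occ : ∀ p s, Occ C p s → s = .init p (C.input p) ∨ ∃ V w, s = .scanned p V ∧ V p = some w ∧
    ViewLE V (C.mem w.level)
  comparable : ∀ p q V W, Occ C p (.scanned p V) → Occ C q (.scanned q W) →
    (State.scanned p V).level = (State.scanned q W).level → ViewLE V W ∨ ViewLE W V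

theorem good_initial (δ : DecisionMap n k) (x : Fin n → Fin (k + 1)) :
    Good δ (Config.initial x) where
  level_state _ := rfl
  mem_some r p s h := by simp [Config.initial] at h
  mem_of_updated p s h := by simp [Config.initial] at h
  occ p s h := by
    rcases h with ⟨r, h⟩ | ⟨h, -⟩
    · simp [Config.initial] at h
    · exact .inl h.symm
  comparable p q V W h _ _ := by
    rcases h with ⟨r, h⟩ | ⟨h, -⟩ <;> simp [Config.initial] at h

/-- The contents of an object only grow, since a process writes its component of each object at most
once. A new scan returns the whole object and so contains every earlier scan of it, which preserves
comparability. -/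
theorem Good.step {δ : DecisionMap n k} {C : Config n k} (hC : Good δ C) {q : Fin n}
    (hq : C.Active δ q) : Good δ (C.step q) := by
  rcases C.exists_updated_or q with ⟨s, hs⟩ | hne
  · have hmem := hC.mem_of_updated q s hs
    have hlev : s.level = C.round q := (hC.mem_some _ _ _ hmem).1
    have hsc : (State.scanned q (C.mem (C.round q))).level = C.round q + 1 := by
      rw [State.level_scanned hmem, hlev]
    rw [Config.step_updated hs]
    have hocc : ∀ p u, Occ (⟨C.input, Function.update C.state q (.scanned q (C.mem (C.round q))),
        Function.update C.round q (C.round q + 1), C.mem⟩ : Config n k) p u →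
        Occ C p u ∨ p = q ∧ u = .scanned q (C.mem (C.round q)) := by
      rintro p u (⟨r, h⟩ | ⟨h, h'⟩)
      · exact .inl (.inl ⟨r, h⟩)
      · by_cases hpq : p = q
        · subst hpq
          exact .inr ⟨rfl, by simpa using h.symm⟩
        · exact .inl (.inr ⟨by simpa [hpq] using h, h'⟩)
    have hle : ∀ p V, Occ C p (.scanned p V) → (State.scanned p V).level = C.round q + 1 →
        ViewLE V (C.mem (C.round q)) := by
      intro p V hV hl
      rcases hC.occ _ _ hV with h | ⟨V', w, h, hw, hle⟩
      · cases h
      · cases h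
        rw [State.level_scanned hw] at hl
        rwa [show w.level = C.round q by omega] at hle
    refine ⟨fun p => ?_, fun r p u h => ?_, fun p u h => ?_, fun p u h => ?_,
      fun p p' V W hV hW hl => ?_⟩
    · by_cases hpq : p = q
      · subst hpq; simpa using hsc
      · simpa [hpq] using hC.level_state p
    · obtain ⟨h1, h2, h3⟩ := hC.mem_some r p u h
      refine ⟨h1, h2, ?_⟩
      by_cases hpq : p = q
      · subst hpq
        left
        simp only [Function.update_self]
        omega
      · simpa [hpq] using h3
    · by_cases hpq : p = q
      · subst hpq; simp at h
      · simp only [Function.update_of_ne hpq] at h ⊢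
        exact hC.mem_of_updated p u h
    · rcases hocc p u h with h | ⟨rfl, rfl⟩
      · exact hC.occ p u h
      · exact .inr ⟨_, s, rfl, hmem, by rw [hlev]; exact fun _ _ h => h⟩
    · rcases hocc _ _ hV with h1 | ⟨rfl, h1⟩ <;> rcases hocc _ _ hW with h2 | ⟨rfl, h2⟩
      · exact hC.comparable _ _ _ _ h1 h2 hl
      · cases h2
        exact .inl (hle _ _ h1 (hl.trans hsc))
      · cases h1
        exact .inr (hle _ _ h2 (hl.symm.trans hsc))
      · cases h1; cases h2
        exact .inl fun _ _ h => h
  · have hnone : C.mem (C.round q) q = none := by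
      by_contra h
      obtain ⟨u, hu⟩ := Option.ne_none_iff_exists'.1 h
      rcases (hC.mem_some _ _ _ hu).2.2 with h | ⟨-, h⟩
      · omega
      · exact hne _ h
    have hocc0 : Occ C q (C.state q) := .inr ⟨rfl, hne⟩
    rw [Config.step_of_ne_updated hne]
    set C' : Config n k := ⟨C.input, Function.update C.state q (.updated (C.state q)), C.round,
      Function.update C.mem (C.round q)
        (Function.update (C.mem (C.round q)) q (some (C.state q)))⟩ with hC'
    have hmem' : ∀ r p u, C'.mem r p = some u →
        C.mem r p = some u ∨ r = C.round q ∧ p = q ∧ u = C.state q := by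
      intro r p u h
      by_cases hr : r = C.round q
      · subst hr
        by_cases hpq : p = q
        · subst hpq
          exact .inr ⟨rfl, rfl, by simpa [hC'] using h.symm⟩
        · exact .inl (by simpa [hC', hpq] using h)
      · exact .inl (by simpa [hC', hr] using h)
    have hmono : ∀ r, ViewLE (C.mem r) (C'.mem r) := by
      intro r p u h
      by_cases hr : r = C.round q
      · subst hr
        by_cases hpq : p = q
        · subst hpq
          rw [hnone] at h; cases h
        · simpa [hC', hpq] using h
      · simpa [hC', hr] using h
    have hocc : ∀ p u, Occ C' p u → Occ C p u := by
      rintro p u (⟨r, h⟩ | ⟨h, h'⟩)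
      · rcases hmem' _ _ _ h with h | ⟨-, rfl, rfl⟩
        · exact .inl ⟨r, h⟩
        · exact hocc0
      · by_cases hpq : p = q
        · subst hpq
          exact absurd (by simpa [hC'] using h.symm) (h' (C.state p))
        · exact .inr ⟨by simpa [hC', hpq] using h, h'⟩
    refine ⟨fun p => ?_, fun r p u h => ?_, fun p u h => ?_, fun p u h => ?_,
      fun p p' V W hV hW hl => ?_⟩
    · by_cases hpq : p = q
      · subst hpq; simpa [hC'] using hC.level_state p
      · simpa [hC', hpq] using hC.level_state p
    · rcases hmem' _ _ _ h with h | ⟨rfl, rfl, rfl⟩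
      · obtain ⟨h1, h2, h3⟩ := hC.mem_some r p u h
        refine ⟨h1, h2, ?_⟩
        by_cases hpq : p = q
        · subst hpq
          rcases h3 with h3 | ⟨-, h3⟩
          · exact .inl h3
          · exact absurd h3 (hne _)
        · simpa [hC', hpq] using h3
      · exact ⟨hC.level_state p, hq, .inr ⟨rfl, by simp [hC']⟩⟩
    · by_cases hpq : p = q
      · subst hpq
        simp only [hC', Function.update_self, State.updated.injEq] at h ⊢
        rw [h]
      · exact hmono _ _ _ (hC.mem_of_updated p u (by simpa [hC', hpq] using h))
    · rcases hC.occ p u (hocc p u h) with h | ⟨V, w, h1, h2, h3⟩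
      · exact .inl h
      · exact .inr ⟨V, w, h1, h2, fun j v hv => hmono _ _ _ (h3 j v hv)⟩
    · exact hC.comparable _ _ _ _ (hocc _ _ hV) (hocc _ _ hW) hl

theorem Good.run {δ : DecisionMap n k} {C : Config n k} (hC : Good δ C) {β : List (Fin n)}
    (hβ : IsSchedule δ C β) : Good δ (C.run β) := by
  induction β generalizing C with
  | nil => exact hC
  | cons q β ih => exact ih (hC.step hβ.1) hβ.2

theorem Reach.good {δ : DecisionMap n k} {C : Config n k} (hC : Reach δ C) : Good δ C := by
  obtain ⟨x, β, hβ, rfl⟩ := hC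
  exact (good_initial δ x).run hβ

theorem reach_initial (δ : DecisionMap n k) (x : Fin n → Fin (k + 1)) :
    Reach δ (Config.initial x) := ⟨x, [], trivial, rfl⟩

theorem Reach.run {δ : DecisionMap n k} {C : Config n k} (hC : Reach δ C) {β : List (Fin n)}
    (hβ : IsSchedule δ C β) : Reach δ (C.run β) := by
  obtain ⟨x, γ, hγ, rfl⟩ := hC
  exact ⟨x, γ ++ β, isSchedule_append.2 ⟨hγ, hβ⟩, (Config.run_append _ _ _).symm⟩

theorem Reach.step {δ : DecisionMap n k} {C : Config n k} (hC : Reach δ C) {q : Fin n}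
    (hq : C.Active δ q) : Reach δ (C.step q) := hC.run (β := [q]) ⟨hq, trivial⟩

theorem Reach.of_le {δ δ' : DecisionMap n k} (h : ∀ s y, δ s = some y → δ' s = some y)
    {C : Config n k} (hC : Reach δ' C) : Reach δ C := by
  obtain ⟨x, β, hβ, rfl⟩ := hC
  exact ⟨x, β, hβ.of_le h, rfl⟩

/-! ### Protocols that agree up to a given level -/

/-- The decision maps `δ` and `δ'` agree on the states with at most `e` scans. -/
def AgreeUpTo (e : ℕ) (δ δ' : DecisionMap n k) : Prop := ∀ s, s.level ≤ e → δ' s = δ s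

theorem State.output_congr {δ δ' : DecisionMap n k} {s : State n k} (h : δ' s = δ s) :
    s.output δ' = s.output δ := by
  cases s <;> simp_all [State.output]

theorem AgreeUpTo.output {e : ℕ} {δ δ' : DecisionMap n k} (h : AgreeUpTo e δ δ') {δ₀ : DecisionMap n k}
    {C : Config n k} (hC : Good δ₀ C) {p : Fin n} (hp : C.round p ≤ e) :
    C.output δ' p = C.output δ p :=
  State.output_congr (h _ (by rwa [hC.level_state]))

/-- Rounds never decrease along a run, so the bound at its end covers every state at which the
decision maps are consulted. -/
theorem IsSchedule.congr {e : ℕ} {δ δ' : DecisionMap n k} (h : AgreeUpTo e δ δ')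
    {C : Config n k} (hC : Good δ C) {β : List (Fin n)} (hr : ∀ p, (C.run β).round p ≤ e)
    (hβ : IsSchedule δ C β) : IsSchedule δ' C β := by
  induction β generalizing C with
  | nil => trivial
  | cons q β ih =>
    refine ⟨?_, ih (hC.step hβ.1) hr hβ.2⟩
    unfold Config.Active
    rw [h.output hC ((C.round_le_run q (q :: β)).trans (hr q))]
    exact hβ.1

theorem Reach.congr {e : ℕ} {δ δ' : DecisionMap n k} (h : AgreeUpTo e δ δ')
    {C : Config n k} (hC : Reach δ C) (hr : ∀ p, C.round p ≤ e) : Reach δ' C := by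
  obtain ⟨x, β, hβ, rfl⟩ := hC
  exact ⟨x, β, hβ.congr h (good_initial δ x) hr, rfl⟩

/-! ### Known inputs -/

/-- Only inputs are known. -/
theorem Good.exists_input {δ : DecisionMap n k} {C : Config n k} (hC : Good δ C)
    {y : Fin (k + 1)} {s : State n k} (hs : Knows y s) {p : Fin n} (hp : Occ C p s) :
    ∃ j, C.input j = y := by
  induction hs generalizing p with
  | init i =>
    rcases hC.occ _ _ hp with h | ⟨_, _, h, -⟩
    · cases h; exact ⟨_, rfl⟩
    · cases h
  | scanned hj _ ih =>
    rcases hC.occ _ _ hp with h | ⟨V, w, h, -, hle⟩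
    · cases h
    · cases h
      exact ih (.inl ⟨_, hle _ _ hj⟩)

/-- Every process knows some input. -/
theorem Good.exists_knows {δ : DecisionMap n k} {C : Config n k} (hC : Good δ C) :
    ∀ (r : ℕ) (p : Fin n) (s : State n k), s.level = r → Occ C p s → ∃ y, Knows y s := by
  intro r
  induction r with
  | zero =>
    intro p s hs hp
    rcases hC.occ _ _ hp with rfl | ⟨V, w, rfl, hw, -⟩
    · exact ⟨_, .init p⟩
    · rw [State.level_scanned hw] at hs; omega
  | succ r ih =>
    intro p s hs hp
    rcases hC.occ _ _ hp with rfl | ⟨V, w, rfl, hw, hle⟩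
    · exact ⟨_, .init p⟩
    · rw [State.level_scanned hw] at hs
      obtain ⟨y, hy⟩ := ih p w (by omega) (.inl ⟨_, hle _ _ hw⟩)
      exact ⟨y, .scanned hw hy⟩

/-- The input of the process that takes the first step is known to all processes that have
performed a scan. -/
theorem knows_first {δ : DecisionMap n k} {x : Fin n → Fin (k + 1)} {i : Fin n} {β : List (Fin n)}
    (hβ : IsSchedule δ (Config.initial x) (i :: β)) {p : Fin n} {V : Fin n → Option (State n k)}
    (hp : Occ ((Config.initial x).run (i :: β)) p (.scanned p V)) :
    Knows (x i) (.scanned p V) := by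
  -- It suffices that the first object keeps the initial state of `i`: a first scan sees it, and a
  -- later scan contains the previous view of the scanning process itself.
  suffices H : ∀ (β : List (Fin n)) (C : Config n k), Good δ C → IsSchedule δ C β →
      C.mem 0 i = some (.init i (x i)) →
      (∀ p V, Occ C p (.scanned p V) → Knows (x i) (.scanned p V)) →
      ∀ p V, Occ (C.run β) p (.scanned p V) → Knows (x i) (.scanned p V) by
    refine H β _ ((good_initial δ x).step hβ.1) hβ.2 ?_ ?_ p V hp
    · rw [Config.step_of_ne_updated (by simp [Config.initial])]
      simp [Config.initial]
    · rw [Config.step_of_ne_updated (by simp [Config.initial])]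
      rintro p V (⟨r, h⟩ | ⟨h, -⟩)
      · by_cases hr : r = 0
        · subst hr
          by_cases hpi : p = i
          · subst hpi; simp [Config.initial] at h
          · simp [Config.initial, hpi] at h
        · simp [Config.initial, hr] at h
      · by_cases hpi : p = i
        · subst hpi; simp [Config.initial] at h
        · simp [Config.initial, hpi] at h
  intro β
  induction β with
  | nil => exact fun C _ _ _ h => h
  | cons q β ih =>
    intro C hC hβ hm hk
    refine ih (C.step q) (hC.step hβ.1) hβ.2 ?_ ?_
    · rcases C.exists_updated_or q with ⟨s, hs⟩ | hne
      · rwa [Config.step_updated hs]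
      · rw [Config.step_of_ne_updated hne]
        have hq : ¬ (C.round q = 0 ∧ q = i) := by
          rintro ⟨h0, rfl⟩
          rcases (hC.mem_some _ _ _ hm).2.2 with h | ⟨-, h⟩
          · omega
          · exact hne _ h
        by_cases h0 : C.round q = 0
        · have : i ≠ q := fun h => hq ⟨h0, h.symm⟩
          simp [h0, this, hm]
        · simp [Ne.symm h0, hm]
    · intro p V hp
      rcases C.exists_updated_or q with ⟨s, hs⟩ | hne
      · rw [Config.step_updated hs] at hp
        rcases hp with ⟨r, h⟩ | ⟨h, h'⟩
        · exact hk p V (.inl ⟨r, h⟩)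
        · by_cases hpq : p = q
          · subst hpq
            simp only [Function.update_self] at h
            rw [← h]
            by_cases h0 : C.round p = 0
            · rw [h0]
              exact .scanned hm (.init i)
            · have hmem := hC.mem_of_updated p s hs
              have hocc : Occ C p s := .inl ⟨_, hmem⟩
              refine .scanned hmem ?_
              rcases hC.occ _ _ hocc with h1 | ⟨W, w, h1, -⟩
              · rw [h1] at hmem
                exact absurd (hC.mem_some _ _ _ hmem).1.symm h0
              · rw [h1] at hocc ⊢
                exact hk p W hocc
          · exact hk p V (.inr ⟨by simpa [hpq] using h, h'⟩)
      · rw [Config.step_of_ne_updated hne] at hp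
        have hocc0 : Occ C q (C.state q) := .inr ⟨rfl, hne⟩
        rcases hp with ⟨r, h⟩ | ⟨h, h'⟩
        · by_cases hr : r = C.round q
          · subst hr
            by_cases hpq : p = q
            · subst hpq
              simp only [Function.update_self, Option.some.injEq] at h
              rw [h] at hocc0
              exact hk p V hocc0
            · exact hk p V (.inl ⟨_, by simpa [hpq] using h⟩)
          · exact hk p V (.inl ⟨_, by simpa [hr] using h⟩)
        · by_cases hpq : p = q
          · subst hpq; simp at h
          · exact hk p V (.inr ⟨by simpa [hpq] using h, h'⟩)

/-! ### Adjacency and the distance between decided states -/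

/-- The states `u` and `v` of two different processes occur in a common reachable configuration. -/
def Adj (δ : DecisionMap n k) (u v : State n k) : Prop :=
  ∃ C p q, Reach δ C ∧ p ≠ q ∧ Occ C p u ∧ Occ C q v

theorem Adj.symm {δ : DecisionMap n k} {u v : State n k} (h : Adj δ u v) : Adj δ v u := by
  obtain ⟨C, p, q, hC, hpq, hu, hv⟩ := h
  exact ⟨C, q, p, hC, hpq.symm, hv, hu⟩

/-- More decisions allow fewer schedules, so adjacency only shrinks under revision, and neighbours
can be studied for the old map. -/
theorem Adj.of_le {δ δ' : DecisionMap n k} (h : ∀ s y, δ s = some y → δ' s = some y)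
    {u v : State n k} (huv : Adj δ' u v) : Adj δ u v := by
  obtain ⟨C, p, q, hC, hpq, hu, hv⟩ := huv
  exact ⟨C, p, q, hC.of_le h, hpq, hu, hv⟩

/-- Adjacent states with the same positive number of scans have comparable views. -/
theorem Adj.comparable {δ : DecisionMap n k} {u v : State n k} {r : ℕ} (h : Adj δ u v)
    (hu : u.level = r + 1) (hv : v.level = r + 1) :
    ∃ p q V W, ∃ w : Fin n × State n k, u = .scanned p V ∧ v = .scanned q W ∧
      V w.1 = some w.2 ∧ W w.1 = some w.2 ∧ w.2.level = r := by
  obtain ⟨C, p, q, hC, hpq, hpu, hqv⟩ := h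
  rcases hC.good.occ _ _ hpu with rfl | ⟨V, v, rfl, hV, -⟩
  · simp at hu
  rcases hC.good.occ _ _ hqv with rfl | ⟨W, w, rfl, hW, -⟩
  · simp at hv
  -- The smaller view contains the state of its own process, and then so does the larger one.
  rcases hC.good.comparable _ _ _ _ hpu hqv (hu.trans hv.symm) with h | h
  · refine ⟨p, q, V, W, (p, v), rfl, rfl, hV, h _ _ hV, ?_⟩
    rw [State.level_scanned hV] at hu
    simpa using hu
  · refine ⟨p, q, V, W, (q, w), rfl, rfl, h _ _ hW, hW, ?_⟩
    rw [State.level_scanned hW] at hv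
    simpa using hv

/-- If a decided state is adjacent to a later state, it is adjacent to the states seen there. -/
theorem Adj.of_scanned {δ : DecisionMap n k} {b : State n k} {i : Fin n}
    {V : Fin n → Option (State n k)} (h : Adj δ (.scanned i V) b) {y : Fin (k + 1)}
    (hb : b.output δ = some y) (hl : b.level < (State.scanned i V).level) {j : Fin n}
    {w : State n k} (hw : V j = some w) :
    Adj δ w b ∧ w.level + 1 = (State.scanned i V).level := by
  obtain ⟨C, p, q, hC, hpq, hu, hqb⟩ := h
  have hG := hC.good
  rcases hG.occ _ _ hu with h | ⟨V', w', h, hV, hle⟩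
  · cases h
  cases h
  have hmem := hle _ _ hw
  obtain ⟨hlev, hout, hround⟩ := hG.mem_some _ _ _ hmem
  rw [State.level_scanned hV] at hl ⊢
  refine ⟨⟨C, j, q, hC, ?_, .inl ⟨_, hmem⟩, hqb⟩, by rw [hlev]⟩
  -- If the process seen were the one in state `b`, it would have written a state of level at least
  -- that of `b`, although it terminated in `b`.
  rintro rfl
  rcases hqb with ⟨r, hr⟩ | ⟨hst, hne⟩
  · rw [(hG.mem_some _ _ _ hr).2.1] at hb
    cases hb
  · have hrb := hG.level_state j
    rw [hst] at hrb
    rcases hround with h | ⟨-, h⟩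
    · omega
    · rw [hst] at h
      exact hne _ h

/-- The invariant of a protocol under construction whose decisions are made after at most `t`
scans: states with at most `t` scans that are decided differently have distance at least three,
and the output of a decided state is known to all its neighbours. -/
structure Inv (δ : DecisionMap n k) (t : ℕ) : Prop where
  level_le : ∀ s y, δ s = some y → s.level ≤ t
  knows : ∀ s y, δ s = some y → Knows y s
  eq_of_adj : ∀ b c y z, Adj δ b c → b.output δ = some y → c.output δ = some z → y = z
  -- Only middle states of level exactly `t` matter; higher levels follow by `Inv.succ`.
  eq_of_adj_adj : ∀ u b c y z, u.level = t → Adj δ u b → Adj δ u c → b.output δ = some y →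
    c.output δ = some z → y = z
  knows_of_adj : ∀ u b y, u.level = t → Adj δ u b → b.output δ = some y → Knows y u

theorem inv_none : Inv (fun _ => none : DecisionMap n k) 0 where
  level_le _ _ h := by cases h
  knows _ _ h := by cases h
  eq_of_adj b _ _ _ _ h := by cases State.output_eq_some h
  eq_of_adj_adj _ b _ _ _ _ _ _ h := by cases State.output_eq_some h
  knows_of_adj _ b _ _ _ h := by cases State.output_eq_some h

theorem Inv.level_le_of_output {δ : DecisionMap n k} {t : ℕ} (h : Inv δ t) {s : State n k}
    {y : Fin (k + 1)} (hs : s.output δ = some y) : s.level ≤ t :=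
  h.level_le _ _ (State.output_eq_some hs)

theorem Adj.exists_scanned {δ : DecisionMap n k} {u v : State n k} {r : ℕ} (h : Adj δ u v)
    (hu : u.level = r + 1) : ∃ p V w, u = .scanned p V ∧ V p = some w ∧ w.level = r := by
  obtain ⟨C, p, q, hC, hpq, hpu, hqv⟩ := h
  rcases hC.good.occ _ _ hpu with rfl | ⟨V, v, rfl, hV, -⟩
  · simp at hu
  · refine ⟨p, V, v, rfl, hV, ?_⟩
    rw [State.level_scanned hV] at hu
    omega

/-- No decision is made on the new level, so a decided neighbour of a state there is also a
neighbour of the state of level `t` in that process's own component. Both conditions reduce to that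
state. -/
theorem Inv.succ {δ : DecisionMap n k} {t : ℕ} (h : Inv δ t) : Inv δ (t + 1) where
  level_le s y hs := (h.level_le s y hs).trans (Nat.le_succ t)
  knows := h.knows
  eq_of_adj := h.eq_of_adj
  eq_of_adj_adj u b c y z hu hb hc hy hz := by
    obtain ⟨p, V, w, rfl, hV, hw⟩ := hb.exists_scanned hu
    have h1 := h.level_le_of_output hy
    have h2 := h.level_le_of_output hz
    exact h.eq_of_adj_adj w b c y z hw (hb.of_scanned hy (by omega) hV).1
      (hc.of_scanned hz (by omega) hV).1 hy hz
  knows_of_adj u b y hu hb hy := by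
    obtain ⟨p, V, w, rfl, hV, hw⟩ := hb.exists_scanned hu
    have h1 := h.level_le_of_output hy
    exact .scanned hV (h.knows_of_adj w b y hw (hb.of_scanned hy (by omega) hV).1 hy)

theorem Inv.mono {δ : DecisionMap n k} {t t' : ℕ} (h : Inv δ t) (ht : t ≤ t') : Inv δ t' := by
  induction ht with
  | refl => exact h
  | step _ ih => exact ih.succ

/-- After one more round, differently decided states have distance at least four. -/
theorem Inv.eq_of_path {δ : DecisionMap n k} {t : ℕ} (h : Inv δ t) {b u v c : State n k}
    {y z : Fin (k + 1)} (hu : u.level = t + 1) (hv : v.level = t + 1) (hub : Adj δ u b)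
    (huv : Adj δ u v) (hvc : Adj δ v c) (hy : b.output δ = some y) (hz : c.output δ = some z) :
    y = z := by
  -- A state common to both views is adjacent to both ends, so the path of length three contracts to
  -- one of length two through level `t`.
  obtain ⟨p, q, V, W, w, rfl, rfl, hV, hW, hw⟩ := huv.comparable hu hv
  have h1 := h.level_le_of_output hy
  have h2 := h.level_le_of_output hz
  exact h.eq_of_adj_adj w.2 b c y z hw (hub.of_scanned hy (by omega) hV).1
    (hvc.of_scanned hz (by omega) hW).1 hy hz

/-! ### Adding one decision -/

open Classical in
/-- The decision map `δ`, changed so that `y` is output in the state `s`. -/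
def decideAt (δ : DecisionMap n k) (s : State n k) (y : Fin (k + 1)) : DecisionMap n k :=
  Function.update δ s (some y)

theorem decideAt_self (δ : DecisionMap n k) (s : State n k) (y : Fin (k + 1)) :
    decideAt δ s y s = some y := by simp [decideAt]

theorem decideAt_of_ne (δ : DecisionMap n k) {s u : State n k} (y : Fin (k + 1)) (h : u ≠ s) :
    decideAt δ s y u = δ u := by simp [decideAt, h]

theorem le_decideAt {δ : DecisionMap n k} {s : State n k} {z : Fin (k + 1)} (h : δ s = none)
    (u : State n k) (y : Fin (k + 1)) (hu : δ u = some y) : decideAt δ s z u = some y := by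
  rw [decideAt_of_ne, hu]
  rintro rfl
  rw [h] at hu
  cases hu

theorem output_decideAt {δ : DecisionMap n k} {s u : State n k} {y z : Fin (k + 1)}
    (h : u.output (decideAt δ s z) = some y) : u.output δ = some y ∨ u = s ∧ y = z := by
  by_cases hu : u = s
  · subst hu
    have := State.output_eq_some h
    rw [decideAt_self] at this
    exact .inr ⟨rfl, (Option.some.inj this).symm⟩
  · rw [State.output_congr (decideAt_of_ne δ z hu)] at h
    exact .inl h

theorem agreeUpTo_decideAt {δ : DecisionMap n k} {s : State n k} {e : ℕ} (y : Fin (k + 1))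
    (h : e < s.level) : AgreeUpTo e δ (decideAt δ s y) := by
  intro u hu
  refine decideAt_of_ne δ y ?_
  rintro rfl
  omega

/-- A state may decide `y` after its last scan if `y` is known to all states seen in it, and these
are not adjacent to states that decide differently. -/
theorem Inv.decideAt {δ : DecisionMap n k} {t : ℕ} (h : Inv δ t) {i : Fin n}
    {V : Fin n → Option (State n k)} {s : State n k} (hi : V i = some s)
    (hs : s.level = t) {y : Fin (k + 1)} (hk : ∀ j w, V j = some w → Knows y w)
    (hadj : ∀ j w c z, V j = some w → Adj δ w c → c.output δ = some z → z = y) :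
    Inv (decideAt δ (.scanned i V) y) (t + 1) := by
  obtain ⟨v, hv⟩ : ∃ v : State n k, v = .scanned i V := ⟨_, rfl⟩
  rw [← hv]
  have hlev : v.level = t + 1 := by rw [hv, State.level_scanned hi, hs]
  have hnone : δ v = none := by
    by_contra hne
    obtain ⟨z, hz⟩ := Option.ne_none_iff_exists'.1 hne
    have := h.level_le _ _ hz
    omega
  have hle := le_decideAt (z := y) hnone
  have hc : ∀ c z, Adj δ v c → c.output δ = some z → z = y := by
    intro c z hvc hz
    have := h.level_le_of_output hz
    exact hadj i s c z hi ((hv ▸ hvc).of_scanned hz (by rw [← hv]; omega) hi).1 hz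
  -- A neighbour on the same level shares a seen state with the new decided state, and that seen
  -- state inherits the decided neighbour `c`.
  have huc : ∀ u c z, u.level = t + 1 → Adj δ u v → Adj δ u c → c.output δ = some z → z = y := by
    intro u c z hu huv huc hz
    obtain ⟨p, q, U, V', w, rfl, h2, hU, hV, hw⟩ := huv.comparable hu hlev
    cases hv.symm.trans h2
    have := h.level_le_of_output hz
    exact hadj w.1 w.2 c z hV (huc.of_scanned hz (by omega) hU).1 hz
  have hku : ∀ u, u.level = t + 1 → Adj δ u v → Knows y u := by
    intro u hu huv
    obtain ⟨p, q, U, V', w, rfl, h2, hU, hV, hw⟩ := huv.comparable hu hlev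
    cases hv.symm.trans h2
    exact .scanned hU (hk _ _ hV)
  have h' := h.succ
  refine ⟨fun u z hu => ?_, fun u z hu => ?_, fun b c z z' hbc hz hz' => ?_,
    fun u b c z z' hu hb hc' hz hz' => ?_, fun u b z hu hb hz => ?_⟩
  · by_cases huv : u = v
    · rw [huv, hlev]
    · rw [decideAt_of_ne δ y huv] at hu
      exact h'.level_le _ _ hu
  · by_cases huv : u = v
    · subst huv
      rw [decideAt_self] at hu
      cases hu
      rw [hv]
      exact .scanned hi (hk _ _ hi)
    · rw [decideAt_of_ne δ y huv] at hu
      exact h.knows _ _ hu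
  · have hbc' := hbc.of_le hle
    rcases output_decideAt hz with h1 | ⟨rfl, rfl⟩ <;>
      rcases output_decideAt hz' with h2 | ⟨rfl, rfl⟩
    · exact h.eq_of_adj _ _ _ _ hbc' h1 h2
    · exact hc _ _ hbc'.symm h1
    · exact (hc _ _ hbc' h2).symm
    · rfl
  · have hb1 := hb.of_le hle
    have hc1 := hc'.of_le hle
    rcases output_decideAt hz with h1 | ⟨rfl, rfl⟩ <;>
      rcases output_decideAt hz' with h2 | ⟨rfl, rfl⟩
    · exact h'.eq_of_adj_adj _ _ _ _ _ hu hb1 hc1 h1 h2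
    · exact huc _ _ _ hu hc1 hb1 h1
    · exact (huc _ _ _ hu hb1 hc1 h2).symm
    · rfl
  · have hb1 := hb.of_le hle
    rcases output_decideAt hz with h1 | ⟨rfl, rfl⟩
    · exact h'.knows_of_adj _ _ _ hu hb1 h1
    · exact hku _ hu hb1

/-- Some value can be output in any state reached two rounds after the last decision. -/
theorem Inv.exists_decideAt {δ : DecisionMap n k} {t : ℕ} (h : Inv δ t) {C : Config n k}
    (hC : Reach δ C) {p : Fin n} {V : Fin n → Option (State n k)} (hp : Occ C p (.scanned p V))
    (hl : (State.scanned p V).level = t + 2) :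
    ∃ y, Inv (NIS.decideAt δ (.scanned p V) y) (t + 2) := by
  have hG := hC.good
  obtain ⟨s, hs, hle⟩ : ∃ s, V p = some s ∧ ViewLE V (C.mem s.level) := by
    rcases hG.occ _ _ hp with h | ⟨V', w, h, hV, hle⟩
    · cases h
    · cases h; exact ⟨w, hV, hle⟩
  rw [State.level_scanned hs] at hl
  have hls : s.level = t + 1 := by omega
  have hocc : ∀ j w, V j = some w → Occ C j w ∧ w.level = t + 1 := fun j w hw =>
    ⟨.inl ⟨_, hle _ _ hw⟩, by rw [← hls]; exact (hG.mem_some _ _ _ (hle _ _ hw)).1⟩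
  -- If a seen state has a decided neighbour, that value is forced. Otherwise any value known to all
  -- seen states is allowed, and the input of the process that moved first is one.
  by_cases hA : ∃ j w c y, V j = some w ∧ Adj δ w c ∧ c.output δ = some y
  · obtain ⟨j, w, c, y, hj, hwc, hy⟩ := hA
    have hyt := h.level_le_of_output hy
    obtain ⟨hjo, hjl⟩ := hocc _ _ hj
    refine ⟨y, h.succ.decideAt hs hls (fun j' w' hw' => ?_) fun j' w' c' z hw' hc' hz => ?_⟩
    · obtain ⟨hjo', hjl'⟩ := hocc _ _ hw'
      by_cases hjj : j' = j
      · subst hjj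
        rw [hj] at hw'
        cases hw'
        exact h.succ.knows_of_adj _ _ _ hjl hwc hy
      -- Two seen states share a state of level `t`. It is adjacent to `c`, so it knows `y`, and so
      -- does whoever has seen it.
      · have hadj : Adj δ w w' := ⟨C, j, j', hC, Ne.symm hjj, hjo, hjo'⟩
        obtain ⟨_, _, W, W', u, rfl, rfl, hW, hW', hu⟩ := hadj.comparable hjl hjl'
        exact .scanned hW' (h.knows_of_adj _ _ _ hu (hwc.of_scanned hy (by omega) hW).1 hy)
    · obtain ⟨hjo', hjl'⟩ := hocc _ _ hw'
      by_cases hjj : j' = j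
      · subst hjj
        rw [hj] at hw'
        cases hw'
        exact h.succ.eq_of_adj_adj _ _ _ _ _ hjl hc' hwc hz hy
      · exact h.eq_of_path hjl' hjl hc' ⟨C, j', j, hC, hjj, hjo', hjo⟩ hwc hz hy
  · obtain ⟨x, β, hβ, rfl⟩ := hC
    cases β with
    | nil =>
      rcases hp with ⟨r, h⟩ | ⟨h, -⟩ <;> simp [Config.initial, Config.run_nil] at h
    | cons i β =>
      refine ⟨x i, h.succ.decideAt hs hls (fun j w hw => ?_) fun j w c z hw hc hz => ?_⟩
      · obtain ⟨hjo, hjl⟩ := hocc _ _ hw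
        rcases hG.occ _ _ hjo with rfl | ⟨W, u, rfl, -⟩
        · simp at hjl
        · exact knows_first hβ hjo
      · exact absurd ⟨j, w, c, z, hw, hc, hz⟩ hA

/-- A decision map that outputs `y` after one more round in which a process sees only itself. -/
theorem Inv.decideAt_solo {δ : DecisionMap n k} {t : ℕ} (h : Inv δ t) {s : State n k}
    (hl : s.level = t) {y : Fin (k + 1)} (hk : Knows y s)
    (hadj : ∀ c z, Adj δ s c → c.output δ = some z → z = y) (p : Fin n) :
    Inv (NIS.decideAt δ (.scanned p (Function.update (fun _ => none) p (some s))) y) (t + 1) := by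
  have hV : ∀ j w, Function.update (fun _ => none : Fin n → Option (State n k)) p (some s) j =
      some w → w = s := by
    intro j w hw
    by_cases hj : j = p
    · subst hj; simpa using hw.symm
    · simp [hj] at hw
  refine h.decideAt (s := s) (by simp) hl (fun j w hw => ?_) fun j w c z hw hc hz => ?_
  · rwa [hV j w hw]
  · rw [hV j w hw] at hc
    exact hadj c z hc hz

/-! ### Completion of a protocol -/

open Classical in
/-- The protocol that decides after `t + 2` scans at the latest: on the value of an adjacent
decided state if there is one, and otherwise on `a` if it is known. -/
def finish (δ : DecisionMap n k) (t : ℕ) (a : Fin (k + 1)) : DecisionMap n k := fun s =>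
  -- The prover may already have found states of level `t + 1` undecided, so these must stay as they
  -- are.
  if s.level ≤ t + 1 then δ s
  else if s.level = t + 2 then
    if h : ∃ y c, Adj δ s c ∧ c.output δ = some y then some h.choose
    else if Knows a s then some a
    else if h : ∃ y, Knows y s then some h.choose
    else none
  else none

theorem agreeUpTo_finish (δ : DecisionMap n k) (t : ℕ) (a : Fin (k + 1)) :
    AgreeUpTo (t + 1) δ (finish δ t a) := fun s hs => by simp [finish, hs]

theorem Inv.le_finish {δ : DecisionMap n k} {t : ℕ} (h : Inv δ t) {a : Fin (k + 1)}
    (s : State n k) (y : Fin (k + 1)) (hs : δ s = some y) :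
    finish δ t a s = some y := by
  rw [agreeUpTo_finish δ t a s ((h.level_le s y hs).trans (Nat.le_succ t)), hs]

/-- Separates outputs forced by a decided neighbour from free choices. In either case, given `Inv`,
no decided neighbour has another value, as `Inv.decideAt_solo` will require. -/
theorem Inv.finish_spec {δ : DecisionMap n k} {t : ℕ} (h : Inv δ t) {a : Fin (k + 1)}
    {s : State n k} {y : Fin (k + 1)} (hs : finish δ t a s = some y)
    (hl : t + 1 < s.level) : s.level = t + 2 ∧ Knows y s ∧
      ((∃ c, Adj δ s c ∧ c.output δ = some y) ∨
        (∀ c z, Adj δ s c → c.output δ ≠ some z) ∧ (Knows a s → y = a)) := by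
  unfold finish at hs
  rw [if_neg (by omega)] at hs
  split at hs
  · next hl2 =>
    refine ⟨hl2, ?_⟩
    split at hs
    · next hex =>
      cases hs
      obtain ⟨c, hc, hz⟩ := hex.choose_spec
      exact ⟨h.succ.succ.knows_of_adj _ _ _ hl2 hc hz, .inl ⟨c, hc, hz⟩⟩
    · next hex =>
      have hno : ∀ c z, Adj δ s c → c.output δ ≠ some z := fun c z hc hz => hex ⟨z, c, hc, hz⟩
      split at hs
      · next hk => cases hs; exact ⟨hk, .inr ⟨hno, fun _ => rfl⟩⟩
      · next hk =>
        split at hs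
        · next hy => cases hs; exact ⟨hy.choose_spec, .inr ⟨hno, fun hk' => absurd hk' hk⟩⟩
        · cases hs
  · cases hs

/-- Every occurring state knows some input, so the default `none` is not reached on level `t + 2`.
Hence the completed protocol is wait-free. -/
theorem finish_ne_none {δ : DecisionMap n k} {t : ℕ} {a : Fin (k + 1)}
    {C : Config n k} (hC : Reach (finish δ t a) C) {p : Fin n}
    {s : State n k} (hp : Occ C p s) (hl : s.level = t + 2) : s.output (finish δ t a) ≠ none := by
  have hk := hC.good.exists_knows _ p s rfl hp
  rcases hC.good.occ _ _ hp with rfl | ⟨V, w, rfl, -⟩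
  · simp at hl
  · rw [State.output]
    unfold finish
    rw [if_neg (by omega), if_pos hl]
    split
    · simp
    · split
      · simp
      · simp

/-- Nobody takes more than `t + 2` scans in the completed protocol. -/
theorem round_le_finish {δ : DecisionMap n k} {t : ℕ} {a : Fin (k + 1)}
    {C : Config n k} (hC : Reach (finish δ t a) C) (p : Fin n) :
    C.round p ≤ t + 2 := by
  obtain ⟨x, β, hβ, rfl⟩ := hC
  suffices H : ∀ (β : List (Fin n)) (C : Config n k), Reach (finish δ t a) C →
      IsSchedule (finish δ t a) C β → (∀ p, C.round p ≤ t + 2) →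
      (∀ p, (C.run β).round p ≤ t + 2) by
    exact H β _ (reach_initial _ x) hβ (fun _ => Nat.zero_le _) p
  intro β
  induction β with
  | nil => exact fun C _ _ h => h
  | cons q β ih =>
    intro C hC hβ hr
    refine ih _ (hC.step hβ.1) hβ.2 fun p => ?_
    rcases C.exists_updated_or q with ⟨s, hs⟩ | hne
    · rw [Config.step_updated hs]
      by_cases hpq : p = q
      · subst hpq
        simp only [Function.update_self]
        have hmem := hC.good.mem_of_updated p s hs
        obtain ⟨h1, h2, -⟩ := hC.good.mem_some _ _ _ hmem
        have hr := hr p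
        by_contra hlt
        exact finish_ne_none hC (s := s) (.inl ⟨_, hmem⟩) (by omega) h2
      · simpa [hpq] using hr p
    · rw [Config.step_of_ne_updated hne]
      exact hr p

theorem weight_le_finish {δ : DecisionMap n k} {t : ℕ} {a : Fin (k + 1)}
    {C : Config n k} (hC : Reach (finish δ t a) C) :
    C.weight ≤ n * (2 * (t + 2) + 1) :=
  Config.weight_le (round_le_finish hC)

/-- The completed protocol is correct if some process with input `a` takes the first step. -/
theorem Inv.correct_finish {δ : DecisionMap n k} {t : ℕ} (h : Inv δ t) {a : Fin (k + 1)}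
    (hk2 : 2 ≤ k) {x : Fin n → Fin (k + 1)} {i : Fin n} (hi : x i = a)
    {β : List (Fin n)} (hβ : IsSchedule (finish δ t a) (Config.initial x) (i :: β)) :
    ((Config.initial x).run (i :: β)).Correct (finish δ t a) := by
  set C := (Config.initial x).run (i :: β) with hCdef
  have hC : Reach (finish δ t a) C := ⟨x, _, hβ, rfl⟩
  have hC' : Reach δ C := hC.of_le (h.le_finish (a := a))
  have hG := hC.good
  have hocc : ∀ p y, C.output (finish δ t a) p = some y → Occ C p (C.state p) := by
    intro p y hy
    refine .inr ⟨rfl, fun s' hs' => ?_⟩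
    unfold Config.output at hy
    rw [hs'] at hy
    cases hy
  have hcase : ∀ p y, C.output (finish δ t a) p = some y →
      Knows y (C.state p) ∧ ((C.state p).output δ = some y ∨ (C.state p).level = t + 2 ∧
        (y = a ∨ ∃ c, Adj δ (C.state p) c ∧ c.output δ = some y)) := by
    intro p y hy
    have hy' := State.output_eq_some hy
    by_cases hl : (C.state p).level ≤ t + 1
    · have hd := State.output_congr (agreeUpTo_finish δ t a _ hl)
      have : (C.state p).output δ = some y := by rw [← hd]; exact hy
      exact ⟨h.knows _ _ (State.output_eq_some this), .inl this⟩
    · obtain ⟨h1, h2, h3⟩ := h.finish_spec hy' (by omega)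
      refine ⟨h2, .inr ⟨h1, ?_⟩⟩
      rcases h3 with h3 | ⟨-, h3⟩
      · exact .inr h3
      · left
        apply h3
        have ho := hocc p y hy
        rcases hG.occ _ _ ho with h4 | ⟨V, w, h4, -⟩
        · rw [h4] at h1
          simp at h1
        · rw [h4] at ho ⊢
          rw [← hi]
          exact knows_first hβ ho
  -- An output other than `a` is an old decision or that of a decided neighbour. Two of them are
  -- thus joined by a path of length at most three between old decisions, which forces equality.
  have key : ∀ p q y z, C.output (finish δ t a) p = some y → C.output (finish δ t a) q = some z →
      y ≠ a → z ≠ a → y = z := by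
    intro p q y z hy hz hya hza
    by_cases hpq : p = q
    · subst hpq
      rw [hy] at hz
      exact Option.some.inj hz
    have hadj : Adj δ (C.state p) (C.state q) := ⟨C, p, q, hC', hpq, hocc p y hy, hocc q z hz⟩
    rcases (hcase p y hy).2 with h1 | ⟨h1, h1'⟩ <;> rcases (hcase q z hz).2 with h2 | ⟨h2, h2'⟩
    · exact h.eq_of_adj _ _ _ _ hadj h1 h2
    · obtain ⟨c, hc, hcz⟩ := h2'.resolve_left hza
      exact h.succ.succ.eq_of_adj_adj _ _ _ _ _ h2 hadj.symm hc h1 hcz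
    · obtain ⟨c, hc, hcy⟩ := h1'.resolve_left hya
      exact h.succ.succ.eq_of_adj_adj _ _ _ _ _ h1 hc hadj hcy h2
    · obtain ⟨c, hc, hcy⟩ := h1'.resolve_left hya
      obtain ⟨d, hd, hdz⟩ := h2'.resolve_left hza
      exact h.succ.eq_of_path h1 h2 hc hadj hd hcy hdz
  refine ⟨fun p y hy => hG.exists_input (hcase p y hy).1 (hocc p y hy), ?_⟩
  have hsub : ∃ z, {y | ∃ p, C.output (finish δ t a) p = some y} ⊆ {a, z} := by
    by_cases hex : ∃ p z, C.output (finish δ t a) p = some z ∧ z ≠ a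
    · obtain ⟨p, z, hz, hza⟩ := hex
      refine ⟨z, ?_⟩
      rintro y ⟨q, hy⟩
      by_cases hya : y = a
      · exact .inl hya
      · exact .inr (key q p y z hy hz hya hza)
    · refine ⟨a, ?_⟩
      rintro y ⟨q, hy⟩
      left
      by_contra hya
      exact hex ⟨q, y, hy, hya⟩
  obtain ⟨z, hz⟩ := hsub
  refine ((Set.ncard_le_ncard hz).trans (Set.ncard_insert_le a {z})).trans ?_
  rwa [Set.ncard_singleton]

/-- Reachable configurations of a protocol under construction are correct. -/
theorem Inv.correct {δ : DecisionMap n k} {t : ℕ} (h : Inv δ t) (hk2 : 2 ≤ k) {C : Config n k}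
    (hC : Reach δ C) : C.Correct δ := by
  have hG := hC.good
  have hocc : ∀ p y, C.output δ p = some y → Occ C p (C.state p) := by
    intro p y hy
    refine .inr ⟨rfl, fun s' hs' => ?_⟩
    unfold Config.output at hy
    rw [hs'] at hy
    cases hy
  refine ⟨fun p y hy =>
    hG.exists_input (h.knows _ _ (State.output_eq_some hy)) (hocc p y hy), ?_⟩
  have : {y | ∃ p, C.output δ p = some y}.Subsingleton := by
    rintro y ⟨p, hy⟩ z ⟨q, hz⟩
    by_cases hpq : p = q
    · subst hpq
      rw [hy] at hz
      exact Option.some.inj hz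
    · exact h.eq_of_adj _ _ _ _ ⟨C, p, q, hC, hpq, hocc p y hy, hocc q z hz⟩ hy hz
  exact (Set.ncard_le_one_iff_subsingleton.2 this).trans (by omega)

/-! ### Extensions of a protocol under construction -/

/-- `(δ', t')` is a later stage of the construction than `(δ, t)`. -/
structure Extends (δ : DecisionMap n k) (t : ℕ) (δ' : DecisionMap n k) (t' : ℕ) : Prop where
  inv : Inv δ' t'
  le : t ≤ t'
  -- One level beyond the bound is frozen as well, since configurations shown to the prover may
  -- reach it.
  agree : AgreeUpTo (t + 1) δ δ'

theorem Inv.extends_refl {δ : DecisionMap n k} {t : ℕ} (h : Inv δ t) : Extends δ t δ t :=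
  ⟨h, le_rfl, fun _ _ => rfl⟩

theorem Extends.trans {δ δ' δ'' : DecisionMap n k} {t t' t'' : ℕ} (h : Extends δ t δ' t')
    (h' : Extends δ' t' δ'' t'') : Extends δ t δ'' t'' :=
  ⟨h'.inv, h.le.trans h'.le, fun s hs => by
    rw [h'.agree s (hs.trans (Nat.succ_le_succ h.le)), h.agree s hs]⟩

theorem Extends.mono {δ δ' : DecisionMap n k} {t t' t'' : ℕ} (h : Extends δ t δ' t')
    (ht : t' ≤ t'') : Extends δ t δ' t'' :=
  ⟨h.inv.mono ht, h.le.trans ht, h.agree⟩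

/-- A value that a set of processes can output in the completed protocol can also be output in
a later stage of the construction. -/
theorem Inv.exists_extends_of_finish {δ : DecisionMap n k} {t : ℕ} (h : Inv δ t) {a : Fin (k + 1)}
    {C : Config n k} (hC : Reach (finish δ t a) C) {Q : Finset (Fin n)} {y : Fin (k + 1)}
    {β : List (Fin n)} (hβ : IsOutputWitness (finish δ t a) C Q y β) :
    ∃ δ' t' β', Extends δ t δ' t' ∧ IsOutputWitness δ' C Q y β' := by
  obtain ⟨hs, hQ, q, hq, hy⟩ := hβ
  set D := C.run β with hD
  have hle := h.le_finish (a := a)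
  have hDR : Reach (finish δ t a) D := hC.run hs
  have hDR' : Reach δ D := hDR.of_le hle
  have hG := hDR'.good
  by_cases hl : (D.state q).level ≤ t + 1
  · refine ⟨δ, t, β, h.extends_refl, hs.of_le hle, hQ, q, hq, ?_⟩
    rw [← hy]
    exact (State.output_congr (agreeUpTo_finish δ t a _ hl)).symm
  obtain ⟨h1, hky, h3⟩ := h.finish_spec (State.output_eq_some hy) (by omega)
  set s := D.state q with hsdef
  have hne : ∀ u, s ≠ .updated u := by
    intro u hu
    unfold Config.output at hy
    rw [← hsdef, hu] at hy
    cases hy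
  have hround : D.round q = t + 2 := by rw [← hG.level_state, ← hsdef, h1]
  have hadj : ∀ c z, Adj δ s c → c.output δ = some z → z = y := by
    intro c z hc hz
    rcases h3 with ⟨d, hd, hdy⟩ | ⟨h3, -⟩
    · exact h.succ.succ.eq_of_adj_adj _ _ _ _ _ h1 hc hd hz hdy
    · exact absurd hz (h3 c z hc)
  -- The output `y` is postponed by one round that `q` runs alone, which leaves all states of level
  -- at most `t + 2` unchanged.
  have hinv := h.succ.succ.decideAt_solo h1 hky hadj q
  set v : State n k := .scanned q (Function.update (fun _ => none) q (some s)) with hv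
  have hvl : v.level = t + 3 := by rw [hv, State.level_scanned (w := s) (by simp), h1]
  have hagree : AgreeUpTo (t + 2) δ (NIS.decideAt δ v y) := agreeUpTo_decideAt y (by omega)
  -- In the completed protocol nobody continues from level `t + 2`, so this object is still empty
  -- and `q` will see only itself.
  have hmem : D.mem (t + 2) = fun _ => none := by
    funext p
    by_contra hp
    obtain ⟨u, hu⟩ := Option.ne_none_iff_exists'.1 hp
    have hu' := hDR.good.mem_some _ _ _ hu
    exact finish_ne_none hDR (.inl ⟨_, hu⟩) hu'.1 hu'.2.1
  have hβ' : IsSchedule (NIS.decideAt δ v y) C β :=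
    (hs.of_le hle).congr hagree (hC.of_le hle).good (round_le_finish hDR)
  have hnone : δ s = none := by
    by_contra hp
    obtain ⟨u, hu⟩ := Option.ne_none_iff_exists'.1 hp
    have := h.level_le _ _ hu
    omega
  have hstep : (D.step q).state q = .updated s := by
    rw [Config.step_of_ne_updated hne]
    simp [← hsdef]
  have hstep2 : ((D.step q).step q).state q = v := by
    rw [Config.step_updated hstep, Config.step_of_ne_updated hne]
    simp [hround, hmem, hv, ← hsdef]
  -- The two extra steps are the update and the scan of the solo round.
  refine ⟨_, t + 3, β ++ [q, q], ⟨hinv, by omega, fun u hu => hagree u (by omega)⟩, ?_, ?_, q, hq, ?_⟩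
  · refine isSchedule_append.2 ⟨hβ', ?_, ?_, trivial⟩
    · unfold Config.Active Config.output
      rw [← hD, ← hsdef, State.output_congr (hagree s (by omega))]
      by_contra hp
      obtain ⟨u, hu⟩ := Option.ne_none_iff_exists'.1 hp
      rw [State.output_eq_some hu] at hnone
      cases hnone
    · unfold Config.Active Config.output
      rw [← hD, hstep]
      rfl
  · intro p hp
    rcases List.mem_append.1 hp with hp | hp
    · exact hQ p hp
    · simp only [List.mem_cons, List.not_mem_nil, or_false, or_self] at hp
      rwa [hp]
  · rw [Config.run_append, ← hD]
    change (((D.step q).step q).state q).output _ = _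
    rw [hstep2, hv, State.output, ← hv, decideAt_self]

/-! ### The adversary -/

theorem IsOutputWitness.congr {e : ℕ} {δ δ' : DecisionMap n k} (h : AgreeUpTo e δ δ')
    {C : Config n k} (hC : Good δ C) {Q : Finset (Fin n)} {y : Fin (k + 1)} {β : List (Fin n)}
    (hβ : IsOutputWitness δ C Q y β) (hr : ∀ p, (C.run β).round p ≤ e) :
    IsOutputWitness δ' C Q y β := by
  obtain ⟨hs, hQ, q, hq, hy⟩ := hβ
  exact ⟨hs.congr h hC hr, hQ, q, hq, by rw [h.output (hC.run hs) (hr q), hy]⟩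

open Classical in
/-- The protocol with decision map `δ'` that gives the same answers to output queries as `R`
where possible. -/
def Protocol.revise (R : Protocol n k) (δ' : DecisionMap n k) : Protocol n k where
  δ := δ'
  answer C Q y :=
    if ∃ β, R.answer C Q y = some β ∧ IsOutputWitness δ' C Q y β then R.answer C Q y
    else if h : ∃ β, IsOutputWitness δ' C Q y β then some h.choose
    else none
  answer_some C Q y β hβ := by
    split at hβ
    · next h =>
      obtain ⟨γ, h1, h2⟩ := h
      rw [h1] at hβ
      cases hβ
      exact h2
    · split at hβ
      · next h => cases hβ; exact h.choose_spec
      · cases hβ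
  answer_none C Q y hn β hβ := by
    split at hn
    · next h =>
      obtain ⟨γ, h1, h2⟩ := h
      rw [h1] at hn
      cases hn
    · rw [dif_pos ⟨β, hβ⟩] at hn
      cases hn

theorem Protocol.answer_revise_of_some {R : Protocol n k} {δ' : DecisionMap n k}
    {C : Config n k} {Q : Finset (Fin n)} {y : Fin (k + 1)} {β : List (Fin n)}
    (h : R.answer C Q y = some β) (hβ : IsOutputWitness δ' C Q y β) :
    (R.revise δ').answer C Q y = some β := by
  rw [← h]
  exact if_pos ⟨β, h, hβ⟩

theorem Protocol.answer_revise_of_none {R : Protocol n k} {δ' : DecisionMap n k}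
    {C : Config n k} {Q : Finset (Fin n)} {y : Fin (k + 1)}
    (h : ∀ β, ¬ IsOutputWitness δ' C Q y β) : (R.revise δ').answer C Q y = none := by
  by_contra hne
  obtain ⟨β, hβ⟩ := Option.ne_none_iff_exists'.1 hne
  exact h β ((R.revise δ').answer_some _ _ _ _ hβ)

/-- The protocol that never decides. -/
def Protocol.undecided (n k : ℕ) : Protocol n k where
  δ := fun _ => none
  answer _ _ _ := none
  answer_some _ _ _ _ h := by cases h
  answer_none _ _ _ _ _ h := by
    obtain ⟨-, -, q, -, h⟩ := h
    cases State.output_eq_some h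

/-- A stage of the construction: the current protocol, in which decisions are made after at most
`bound` scans; `fixed` means that it will not be changed any more. -/
structure Stage (n k : ℕ) : Type where
  prot : Protocol n k
  bound : ℕ
  fixed : Bool

/-- A reply to the query `(C, q)` makes the adversary revise its protocol to `δ'`. -/
def Stage.QueryRevision (S : Stage n k) (C : Config n k) (q : Fin n) (δ' : DecisionMap n k) : Prop :=
  Extends S.prot.δ S.bound δ' (S.bound + 2) ∧ ((C.step q).state q).level = S.bound + 2 ∧
    (C.step q).output δ' q ≠ none

/-- A reply to the output query `(C, Q, y)` makes the adversary revise its protocol to `δ'`. -/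
def Stage.OutputRevision (S : Stage n k) (C : Config n k) (Q : Finset (Fin n)) (y : Fin (k + 1))
    (r : DecisionMap n k × ℕ) : Prop :=
  Extends S.prot.δ S.bound r.1 r.2 ∧
    ∃ β, (S.prot.revise r.1).answer C Q y = some β ∧ ∀ p, (C.run β).round p ≤ r.2 + 1

open Classical in
/-- The next stage, after a move of the prover: a state reached for the first time with
`bound + 2` scans becomes decided; the answer to an output query is positive if this is possible
at any later stage; at the end of the first phase, the protocol is completed. -/
def Stage.next (S : Stage n k) (m : Move n k) : Stage n k :=
  if S.fixed then S
  else match m with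
    | .query C q =>
      if h : ∃ δ', S.QueryRevision C q δ' then ⟨S.prot.revise h.choose, S.bound + 2, false⟩ else S
    | .output C Q y =>
      if h : ∃ r, S.OutputRevision C Q y r then ⟨S.prot.revise h.choose.1, h.choose.2, false⟩ else S
    | .commit _ [] => S
    | .commit x (i :: _) => ⟨S.prot.revise (finish S.prot.δ S.bound (x i)), S.bound, true⟩

/-- The stage of the construction after the given moves. -/
def stageAfter (ms : List (Move n k)) : Stage n k :=
  ms.foldl Stage.next ⟨Protocol.undecided n k, 0, false⟩

theorem stageAfter_concat (ms : List (Move n k)) (m : Move n k) :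
    stageAfter (ms ++ [m]) = (stageAfter ms).next m := by
  simp [stageAfter]

theorem Game.after_concat (ms : List (Move n k)) (m : Move n k) :
    Game.after (ms ++ [m]) = (Game.after ms).next m := by
  simp [Game.after]

/-- The adversary that answers according to the protocol of the current stage. -/
def adversary (n k : ℕ) : Adversary n k := fun ms => (stageAfter ms).prot

/-! ### Invariants of the phases -/

/-- The invariant of the first phase. -/
structure FirstPhase (ms : List (Move n k)) (S : Stage n k) : Prop where
  not_commit : ∀ m ∈ ms, ¬ m.IsCommit
  fixed : S.fixed = false
  inv : Inv S.prot.δ S.bound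
  sched : (Game.after ms).sched = []
  inits : (Game.after ms).inits = Set.univ
  reached : ∀ ms', ms' <+: ms → ∀ C ∈ (Game.after ms').base ∪ (Game.after ms').reached,
    Reach S.prot.δ C ∧ ∀ p, C.round p ≤ S.bound + 1
  queried : ∀ C q, Move.query C q ∈ ms → Reach S.prot.δ (C.step q) ∧
    ∀ p, (C.step q).round p ≤ S.bound + 1
  asked : ∀ C Q y, Move.output C Q y ∈ ms → Reach S.prot.δ C ∧ (∀ p, C.round p ≤ S.bound + 1)
  answer_some : ∀ C Q y β, Move.output C Q y ∈ ms → S.prot.answer C Q y = some β →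
    ∀ p, (C.run β).round p ≤ S.bound + 1
  -- An answer NONE has to survive all revisions, so it is a promise about every later stage.
  answer_none : ∀ C Q y, Move.output C Q y ∈ ms → S.prot.answer C Q y = none →
    ∀ δ' t' β, Extends S.prot.δ S.bound δ' t' → ¬ IsOutputWitness δ' C Q y β

/-- The invariant of the later phases. -/
structure LaterPhase (ms : List (Move n k)) (S : Stage n k) : Prop where
  exists_commit : ∃ m ∈ ms, m.IsCommit
  fixed : S.fixed = true
  inits_nonempty : (Game.after ms).inits.Nonempty
  finish : ∃ δ a i β, Inv δ S.bound ∧ S.prot.δ = finish δ S.bound a ∧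
    (Game.after ms).sched = i :: β ∧ ∀ x ∈ (Game.after ms).inits, x i = a
  schedule : ∀ x ∈ (Game.after ms).inits,
    IsSchedule S.prot.δ (Config.initial x) (Game.after ms).sched
  reached : ∀ C ∈ (Game.after ms).reached, ∃ C₀ ∈ (Game.after ms).base, ∃ γ,
    IsSchedule S.prot.δ C₀ γ ∧ C = C₀.run γ

/-- The reply to any earlier move is the same for the revised protocol. -/
theorem FirstPhase.reply_eq {ms : List (Move n k)} {S : Stage n k} (h : FirstPhase ms S)
    {δ' : DecisionMap n k} (hagree : AgreeUpTo (S.bound + 1) S.prot.δ δ')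
    (hnone : ∀ C Q y, Move.output C Q y ∈ ms → S.prot.answer C Q y = none →
      ∀ β, ¬ IsOutputWitness δ' C Q y β) {m : Move n k} (hm : m ∈ ms) :
    (S.prot.revise δ').reply m = S.prot.reply m := by
  cases m with
  | query C q =>
    obtain ⟨h1, h2⟩ := h.queried C q hm
    exact congrArg _ (hagree.output h1.good (h2 q))
  | output C Q y =>
    refine congrArg Reply.answer ?_
    cases ha : S.prot.answer C Q y with
    | none => exact Protocol.answer_revise_of_none (hnone C Q y hm ha)
    | some β =>
      exact Protocol.answer_revise_of_some ha ((S.prot.answer_some _ _ _ _ ha).congr hagree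
        (h.asked C Q y hm).1.good (h.answer_some C Q y β hm ha))
  | commit x β => rfl

/-- What the prover has been shown lies on levels at most `S.bound + 1`, where later stages agree
with `S`; answers NONE already account for all later stages. -/
theorem FirstPhase.extend {ms : List (Move n k)} {S : Stage n k} (h : FirstPhase ms S)
    {δ' : DecisionMap n k} {t' : ℕ} (he : Extends S.prot.δ S.bound δ' t') :
    FirstPhase ms ⟨S.prot.revise δ', t', false⟩ ∧
      ∀ m ∈ ms, (S.prot.revise δ').reply m = S.prot.reply m := by
  have hreply : ∀ m ∈ ms, (S.prot.revise δ').reply m = S.prot.reply m := fun m hm =>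
    h.reply_eq he.agree (fun C Q y hm hn β => h.answer_none C Q y hm hn δ' t' β he) hm
  have hle := Nat.succ_le_succ he.le
  have hans : ∀ C Q y, Move.output C Q y ∈ ms →
      (S.prot.revise δ').answer C Q y = S.prot.answer C Q y := fun C Q y hm => by
    simpa [Protocol.reply] using hreply _ hm
  refine ⟨⟨h.not_commit, rfl, he.inv, h.sched, h.inits, fun ms' hms' C hC => ?_,
    fun C q hm => ?_, fun C Q y hm => ?_, fun C Q y β hm ha p => ?_,
    fun C Q y hm ha δ'' t'' β he' => ?_⟩, hreply⟩
  · obtain ⟨h1, h2⟩ := h.reached ms' hms' C hC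
    exact ⟨h1.congr he.agree h2, fun p => (h2 p).trans hle⟩
  · obtain ⟨h1, h2⟩ := h.queried C q hm
    exact ⟨h1.congr he.agree h2, fun p => (h2 p).trans hle⟩
  · obtain ⟨h1, h2⟩ := h.asked C Q y hm
    exact ⟨h1.congr he.agree h2, fun p => (h2 p).trans hle⟩
  · exact (h.answer_some C Q y β hm ((hans C Q y hm).symm.trans ha) p).trans hle
  · exact h.answer_none C Q y hm ((hans C Q y hm).symm.trans ha) δ'' t'' β (he.trans he')

theorem FirstPhase.initial_stage :
    FirstPhase ([] : List (Move n k)) ⟨Protocol.undecided n k, 0, false⟩ where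
  not_commit := by simp
  fixed := rfl
  inv := inv_none
  sched := rfl
  inits := rfl
  reached ms' h C hC := by
    rw [List.prefix_nil.1 h] at hC
    rcases hC with ⟨x, -, rfl⟩ | hC
    · exact ⟨reach_initial _ x, fun p => Nat.zero_le _⟩
    · cases hC
  queried := by simp
  asked := by simp
  answer_some := by simp
  answer_none := by simp

/-- A query reaches a state that has been considered before, or the adversary can make it
decided. -/
theorem Inv.query {S : Stage n k} (h : Inv S.prot.δ S.bound) {C : Config n k}
    (hC : Reach S.prot.δ C) (hr : ∀ p, C.round p ≤ S.bound + 1) {q : Fin n}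
    (hq : C.Active S.prot.δ q) : (∀ p, (C.step q).round p ≤ S.bound + 1) ∨
      (∀ p, (C.step q).round p ≤ S.bound + 2) ∧ ∃ δ', S.QueryRevision C q δ' := by
  rcases C.exists_updated_or q with ⟨s, hs⟩ | hne
  · have hstep := Config.step_updated hs
    have hrn : ∀ p, p ≠ q → (C.step q).round p ≤ S.bound + 1 := fun p hp => by
      rw [hstep]; simpa [hp] using hr p
    have hrq : (C.step q).round q = C.round q + 1 := by rw [hstep]; simp
    by_cases hlt : C.round q + 1 ≤ S.bound + 1
    · left
      intro p
      by_cases hp : p = q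
      · subst hp; omega
      · exact hrn p hp
    · right
      have := hr q
      refine ⟨fun p => ?_, ?_⟩
      · by_cases hp : p = q
        · subst hp; omega
        · exact (hrn p hp).trans (by omega)
      · have hCq := hC.step hq
        have hst : (C.step q).state q = .scanned q (C.mem (C.round q)) := by rw [hstep]; simp
        have hl := hCq.good.level_state q
        have hlev : (State.scanned q (C.mem (C.round q))).level = S.bound + 2 := by
          rw [← hst, hl, hrq]; omega
        obtain ⟨y, hy⟩ := h.exists_decideAt hCq (.inr ⟨hst, by simp⟩) hlev
        refine ⟨_, ⟨hy, by omega, agreeUpTo_decideAt y (by omega)⟩, by rw [hst, hlev], ?_⟩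
        rw [Config.output, hst, State.output, decideAt_self]
        simp
  · left
    rw [Config.step_of_ne_updated hne]
    exact hr

theorem FirstPhase.concat_query {ms : List (Move n k)} {S : Stage n k} (h : FirstPhase ms S)
    {C : Config n k} {q : Fin n} (hC : C ∈ (Game.after ms).base ∪ (Game.after ms).reached)
    (hq : C.Active S.prot.δ q) (hr : ∀ p, (C.step q).round p ≤ S.bound + 1) :
    FirstPhase (ms ++ [.query C q]) S := by
  have hCq := (h.reached ms List.prefix_rfl C hC).1.step hq
  refine ⟨?_, h.fixed, h.inv, ?_, ?_, fun ms' hms' D hD => ?_, ?_, ?_, ?_, ?_⟩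
  · simpa [or_imp, forall_and, Move.IsCommit] using h.not_commit
  · rw [Game.after_concat]; exact h.sched
  · rw [Game.after_concat]; exact h.inits
  · rcases List.prefix_concat_iff.1 hms' with rfl | hms'
    · rw [Game.after_concat] at hD
      rcases hD with hD | rfl | hD
      · exact h.reached ms List.prefix_rfl D (.inl hD)
      · exact ⟨hCq, hr⟩
      · exact h.reached ms List.prefix_rfl D (.inr hD)
    · exact h.reached ms' hms' D hD
  · intro D p hm
    rcases List.mem_append.1 hm with hm | hm
    · exact h.queried D p hm
    · simp only [List.mem_singleton, Move.query.injEq] at hm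
      obtain ⟨rfl, rfl⟩ := hm
      exact ⟨hCq, hr⟩
  all_goals
    intro D Q y
    simp only [List.mem_append, List.mem_singleton, reduceCtorEq, or_false]
  · exact h.asked D Q y
  · exact h.answer_some D Q y
  · exact h.answer_none D Q y

theorem FirstPhase.concat_output {ms : List (Move n k)} {S : Stage n k} (h : FirstPhase ms S)
    {C : Config n k} {Q : Finset (Fin n)} {y : Fin (k + 1)}
    (hC : C ∈ (Game.after ms).base ∪ (Game.after ms).reached)
    (hsome : ∀ β, S.prot.answer C Q y = some β → ∀ p, (C.run β).round p ≤ S.bound + 1)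
    (hnone : S.prot.answer C Q y = none →
      ∀ δ' t' β, Extends S.prot.δ S.bound δ' t' → ¬ IsOutputWitness δ' C Q y β) :
    FirstPhase (ms ++ [.output C Q y]) S := by
  have hmem : ∀ D Q' z, Move.output D Q' z ∈ ms ++ [.output C Q y] →
      Move.output D Q' z ∈ ms ∨ D = C ∧ Q' = Q ∧ z = y := by
    intro D Q' z hm
    rcases List.mem_append.1 hm with hm | hm
    · exact .inl hm
    · simp only [List.mem_singleton, Move.output.injEq] at hm
      exact .inr hm
  refine ⟨?_, h.fixed, h.inv, ?_, ?_, fun ms' hms' D hD => ?_, fun D p hm => ?_,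
    fun D Q' z hm => ?_, fun D Q' z β hm => ?_, fun D Q' z hm => ?_⟩
  · simpa [or_imp, forall_and, Move.IsCommit] using h.not_commit
  · rw [Game.after_concat]; exact h.sched
  · rw [Game.after_concat]; exact h.inits
  · rcases List.prefix_concat_iff.1 hms' with rfl | hms'
    · rw [Game.after_concat] at hD
      exact h.reached ms List.prefix_rfl D hD
    · exact h.reached ms' hms' D hD
  · exact h.queried D p (by simpa using hm)
  · rcases hmem _ _ _ hm with hm | ⟨rfl, rfl, rfl⟩
    · exact h.asked D Q' z hm
    · exact h.reached ms List.prefix_rfl _ hC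
  · rcases hmem _ _ _ hm with hm | ⟨rfl, rfl, rfl⟩
    · exact h.answer_some D Q' z β hm
    · exact hsome β
  · rcases hmem _ _ _ hm with hm | ⟨rfl, rfl, rfl⟩
    · exact h.answer_none D Q' z hm
    · exact hnone

theorem isSchedule_initial_congr {δ : DecisionMap n k} {x x' : Fin n → Fin (k + 1)}
    {β : List (Fin n)} (h : IsSchedule δ (Config.initial x) β) (hx : ∀ i ∈ β, x' i = x i) :
    IsSchedule δ (Config.initial x') β :=
  IsSchedule.congr_input (C := Config.initial x) rfl
    (fun p hp => ⟨by simp [Config.initial, hx p hp], rfl⟩) h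

/-- The prover may commit only to a configuration it has reached, so the schedule stays within the
frozen levels and survives the completion. Its first process supplies `a`, an input shared by all
remaining initial configurations. -/
theorem FirstPhase.concat_commit {ms : List (Move n k)} {S : Stage n k} (h : FirstPhase ms S)
    {x : Fin n → Fin (k + 1)} {i : Fin n} {β : List (Fin n)}
    (hl : (Game.after ms).Legal S.prot.δ (.commit x (i :: β))) :
    LaterPhase (ms ++ [.commit x (i :: β)])
      ⟨S.prot.revise (NIS.finish S.prot.δ S.bound (x i)), S.bound, true⟩ := by
  obtain ⟨-, -, hs, hr⟩ := hl
  rw [h.sched, Config.run_nil] at hs hr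
  have hround := (h.reached ms List.prefix_rfl _ (.inr hr)).2
  have hs' : IsSchedule (NIS.finish S.prot.δ S.bound (x i)) (Config.initial x) (i :: β) :=
    hs.congr (agreeUpTo_finish _ _ _) (good_initial _ x) hround
  have hsched : (Game.after (ms ++ [.commit x (i :: β)])).sched = i :: β := by
    rw [Game.after_concat, Game.next, h.sched, List.nil_append]
  have hinits : (Game.after (ms ++ [.commit x (i :: β)])).inits =
      {x' | ∀ j ∈ i :: β, x' j = x j} := by
    rw [Game.after_concat, Game.next, h.sched, List.nil_append]
  refine ⟨⟨_, List.mem_append_right _ (List.mem_singleton_self _), trivial⟩, rfl, ?_,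
    ⟨_, x i, i, β, h.inv, rfl, hsched, ?_⟩, ?_, ?_⟩
  · rw [hinits]
    exact ⟨x, fun _ _ => rfl⟩
  · rw [hinits]
    exact fun x' hx' => hx' i (by simp)
  · rw [hinits, hsched]
    exact fun x' hx' => isSchedule_initial_congr hs' hx'
  · rw [Game.after_concat]
    exact fun C hC => absurd hC (Set.notMem_empty C)

theorem LaterPhase.concat {ms : List (Move n k)} {S : Stage n k} (h : LaterPhase ms S)
    {m : Move n k} (hl : (Game.after ms).Legal S.prot.δ m) : LaterPhase (ms ++ [m]) S := by
  obtain ⟨m₀, hm₀, hcommit⟩ := h.exists_commit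
  have hex : ∃ m' ∈ ms ++ [m], m'.IsCommit := ⟨m₀, List.mem_append_left _ hm₀, hcommit⟩
  cases m with
  | query C q =>
    refine ⟨hex, h.fixed, ?_, ?_, ?_, ?_⟩ <;> rw [Game.after_concat]
    · exact h.inits_nonempty
    · exact h.finish
    · exact h.schedule
    · rintro D (rfl | hD)
      · rcases hl.1 with hC | hC
        · exact ⟨C, hC, [q], ⟨hl.2, trivial⟩, rfl⟩
        · obtain ⟨C₀, h0, γ, hγ, rfl⟩ := h.reached C hC
          exact ⟨C₀, h0, γ ++ [q], isSchedule_append.2 ⟨hγ, hl.2, trivial⟩,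
            (Config.run_append C₀ γ [q]).symm⟩
      · exact h.reached D hD
  | output C Q y =>
    refine ⟨hex, h.fixed, ?_, ?_, ?_, ?_⟩ <;> rw [Game.after_concat]
    · exact h.inits_nonempty
    · exact h.finish
    · exact h.schedule
    · exact h.reached
  | commit x β =>
    obtain ⟨hx, hne, hs, hr⟩ := hl
    have hall : IsSchedule S.prot.δ (Config.initial x) ((Game.after ms).sched ++ β) :=
      isSchedule_append.2 ⟨h.schedule x hx, hs⟩
    refine ⟨hex, h.fixed, ?_, ?_, ?_, ?_⟩ <;> rw [Game.after_concat]
    · exact ⟨x, fun _ _ => rfl⟩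
    · obtain ⟨δ, a, i, γ, hinv, hδ, hsched, ha⟩ := h.finish
      refine ⟨δ, a, i, γ ++ β, hinv, hδ, by simp [Game.next, hsched], fun x' hx' => ?_⟩
      rw [hx' i (by simp [hsched]), ha x hx]
    · exact fun x' hx' => isSchedule_initial_congr hall hx'
    · exact fun C hC => absurd hC (Set.notMem_empty C)

theorem FirstPhase.next {ms : List (Move n k)} {S : Stage n k} (h : FirstPhase ms S)
    {m : Move n k} (hl : (Game.after ms).Legal S.prot.δ m) :
    AgreeUpTo (S.bound + 1) S.prot.δ (S.next m).prot.δ ∧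
      (∀ m' ∈ ms, (S.next m).prot.reply m' = S.prot.reply m') ∧
      (FirstPhase (ms ++ [m]) (S.next m) ∨ LaterPhase (ms ++ [m]) (S.next m)) := by
  have hf : ¬ S.fixed = true := by simp [h.fixed]
  unfold Stage.next
  rw [if_neg hf]
  cases m with
  | query C q =>
    obtain ⟨hC, hr⟩ := h.reached ms List.prefix_rfl C hl.1
    have hstep := h.inv.query hC hr hl.2
    simp only
    split
    · next hex =>
      obtain ⟨he, hlev, -⟩ := hex.choose_spec
      obtain ⟨h1, h2⟩ := h.extend he
      refine ⟨he.agree, h2, .inl (h1.concat_query hl.1 ?_ ?_)⟩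
      · exact (he.agree.output hC.good (hr q)).trans hl.2
      · rcases hstep with hstep | ⟨hstep, -⟩
        · exact fun p => (hstep p).trans (Nat.succ_le_succ he.le)
        · exact fun p => (hstep p).trans (Nat.le_succ _)
    · next hex =>
      refine ⟨fun _ _ => rfl, fun _ _ => rfl, .inl (h.concat_query hl.1 hl.2 ?_)⟩
      exact hstep.resolve_right fun h => hex h.2
  | output C Q y =>
    simp only
    split
    · next hex =>
      obtain ⟨he, β, hβ, hr⟩ := hex.choose_spec
      obtain ⟨h1, h2⟩ := h.extend he
      refine ⟨he.agree, h2, .inl (h1.concat_output hl.1 ?_ ?_)⟩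
      · intro γ hγ
        cases hβ.symm.trans hγ
        exact hr
      · intro hn
        cases hβ.symm.trans hn
    · next hex =>
      have hno : ∀ δ' t' β, Extends S.prot.δ S.bound δ' t' → ¬ IsOutputWitness δ' C Q y β := by
        intro δ' t' β he hβ
        have hne : (S.prot.revise δ').answer C Q y ≠ none := fun hn =>
          (S.prot.revise δ').answer_none C Q y hn β hβ
        obtain ⟨γ, hγ⟩ := Option.ne_none_iff_exists'.1 hne
        -- A larger bound is harmless by `Extends.mono`; the sum dominates all rounds reached by the
        -- schedule that the revised protocol returns.
        refine hex ⟨(δ', max t' (∑ p, (C.run γ).round p)), he.mono (le_max_left _ _), γ, hγ,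
          fun p => ?_⟩
        exact (Finset.single_le_sum (fun _ _ => Nat.zero_le _) (Finset.mem_univ p)).trans
          ((le_max_right _ _).trans (Nat.le_succ _))
      refine ⟨fun _ _ => rfl, fun _ _ => rfl, .inl (h.concat_output hl.1 ?_ fun _ => hno)⟩
      intro β hβ
      exact absurd (S.prot.answer_some _ _ _ _ hβ) (hno _ _ β h.inv.extends_refl)
  | commit x β =>
    cases β with
    | nil => exact absurd rfl hl.2.1
    | cons i β =>
      refine ⟨agreeUpTo_finish _ _ _, fun m hm => ?_, .inr (h.concat_commit hl)⟩
      -- The completed map need not satisfy `Inv`, so it is not itself a later stage; but a witness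
      -- for it yields one for a later stage, against the promise made with NONE.
      refine h.reply_eq (agreeUpTo_finish _ _ _) (fun C Q y hm hn β hβ => ?_) hm
      obtain ⟨hC, hr⟩ := h.asked C Q y hm
      obtain ⟨δ', t', β', he, hβ'⟩ :=
        h.inv.exists_extends_of_finish (hC.congr (agreeUpTo_finish _ _ _) hr) hβ
      exact h.answer_none C Q y hm hn δ' t' β' he hβ'

theorem LaterPhase.next_eq {ms : List (Move n k)} {S : Stage n k} (h : LaterPhase ms S)
    (m : Move n k) : S.next m = S := by
  unfold Stage.next
  rw [if_pos h.fixed]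

/-! ### Legal plays against the adversary -/

theorem legalPlay_concat {adv : Adversary n k} {ms : List (Move n k)} {m : Move n k} :
    LegalPlay adv (ms ++ [m]) ↔ LegalPlay adv ms ∧ (Game.after ms).Legal (adv ms).δ m := by
  constructor
  · intro h
    exact ⟨fun ms' m' h' => h ms' m' (h'.trans (List.prefix_append _ _)), h ms m List.prefix_rfl⟩
  · rintro ⟨h1, h2⟩ ms' m' h'
    rcases List.prefix_concat_iff.1 h' with h' | h'
    · obtain ⟨rfl, h3⟩ := List.append_inj' h' rfl
      obtain rfl := List.singleton_inj.1 h3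
      exact h2
    · exact h1 ms' m' h'

/-- The invariants hold as long as the moves are legal. -/
theorem firstPhase_or_laterPhase {ms : List (Move n k)} (h : LegalPlay (adversary n k) ms) :
    FirstPhase ms (stageAfter ms) ∨ LaterPhase ms (stageAfter ms) := by
  induction ms using List.reverseRecOn with
  | nil => exact .inl FirstPhase.initial_stage
  | append_singleton ms m ih =>
    obtain ⟨h1, h2⟩ := legalPlay_concat.1 h
    rw [stageAfter_concat]
    rcases ih h1 with ih | ih
    · exact (ih.next h2).2.2
    · rw [ih.next_eq]
      exact .inr (ih.concat h2)

theorem FirstPhase.of_legalPlay {ms : List (Move n k)} (h : LegalPlay (adversary n k) ms)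
    (hc : ∀ m ∈ ms, ¬ m.IsCommit) : FirstPhase ms (stageAfter ms) := by
  rcases firstPhase_or_laterPhase h with h' | h'
  · exact h'
  · obtain ⟨m, hm, h⟩ := h'.exists_commit
    exact absurd h (hc m hm)

theorem LaterPhase.of_legalPlay {ms : List (Move n k)} (h : LegalPlay (adversary n k) ms)
    (hc : ∃ m ∈ ms, m.IsCommit) : LaterPhase ms (stageAfter ms) := by
  rcases firstPhase_or_laterPhase h with h' | h'
  · obtain ⟨m, hm, h⟩ := hc
    exact absurd h (h'.not_commit m hm)
  · exact h'

/-- The adversary never changes the outputs in configurations reached earlier. -/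
theorem output_stable {ms ms' : List (Move n k)} (h : LegalPlay (adversary n k) ms)
    (hp : ms' <+: ms) {C : Config n k}
    (hC : C ∈ (Game.after ms').base ∪ (Game.after ms').reached) (p : Fin n) :
    C.output (adversary n k ms).δ p = C.output (adversary n k ms').δ p := by
  induction ms using List.reverseRecOn with
  | nil => rw [List.prefix_nil.1 hp]
  | append_singleton ms m ih =>
    obtain ⟨h1, h2⟩ := legalPlay_concat.1 h
    rcases List.prefix_concat_iff.1 hp with rfl | hp
    · rfl
    · rw [← ih h1 hp]
      unfold adversary
      rw [stageAfter_concat]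
      rcases firstPhase_or_laterPhase h1 with h' | h'
      · obtain ⟨h3, h4⟩ := h'.reached _ hp C hC
        exact (h'.next h2).1.output h3.good (h4 p)
      · rw [h'.next_eq]

theorem coherent_adversary : Coherent (adversary n k) := by
  intro ms ms' h hp m hm
  induction ms using List.reverseRecOn with
  | nil => rw [List.prefix_nil.1 hp]
  | append_singleton ms m' ih =>
    obtain ⟨h1, h2⟩ := legalPlay_concat.1 h
    rcases List.prefix_concat_iff.1 hp with rfl | hp
    · rfl
    · rw [← ih h1 hp]
      unfold adversary
      rw [stageAfter_concat]
      rcases firstPhase_or_laterPhase h1 with h' | h'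
      · exact (h'.next h2).2.1 m (hp.subset hm)
      · rw [h'.next_eq]

theorem adversary_eq_of_commit {ms ms' : List (Move n k)} (h : LegalPlay (adversary n k) ms')
    (hp : ms <+: ms') (hc : ∃ m ∈ ms, m.IsCommit) : stageAfter ms' = stageAfter ms := by
  induction ms' using List.reverseRecOn with
  | nil => rw [List.prefix_nil.1 hp]
  | append_singleton ms' m ih =>
    obtain ⟨h1, h2⟩ := legalPlay_concat.1 h
    rcases List.prefix_concat_iff.1 hp with rfl | hp
    · rfl
    · obtain ⟨m₀, hm₀, hc⟩ := hc
      rw [stageAfter_concat, (LaterPhase.of_legalPlay h1 ⟨m₀, hp.subset hm₀, hc⟩).next_eq, ih h1 hp]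

theorem LaterPhase.reach {ms : List (Move n k)} {S : Stage n k} (h : LaterPhase ms S)
    {C : Config n k} (hC : C ∈ (Game.after ms).base ∪ (Game.after ms).reached) :
    ∃ x ∈ (Game.after ms).inits, ∃ γ,
      IsSchedule S.prot.δ (Config.initial x) ((Game.after ms).sched ++ γ) ∧
        C = (Config.initial x).run ((Game.after ms).sched ++ γ) := by
  obtain ⟨C₀, ⟨x, hx, rfl⟩, γ, hγ, rfl⟩ : ∃ C₀ ∈ (Game.after ms).base, ∃ γ,
      IsSchedule S.prot.δ C₀ γ ∧ C = C₀.run γ := by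
    rcases hC with hC | hC
    · exact ⟨C, hC, [], trivial, rfl⟩
    · exact h.reached C hC
  exact ⟨x, hx, γ, isSchedule_append.2 ⟨h.schedule x hx, hγ⟩, (Config.run_append _ _ _).symm⟩

theorem LaterPhase.weight_le {ms : List (Move n k)} {S : Stage n k} (h : LaterPhase ms S)
    {C : Config n k} (hC : Reach S.prot.δ C) : C.weight ≤ n * (2 * (S.bound + 2) + 1) := by
  obtain ⟨δ, a, i, β, hinv, hδ, -⟩ := h.finish
  rw [hδ] at hC
  exact weight_le_finish hC

theorem LaterPhase.correct {ms : List (Move n k)} {S : Stage n k} (h : LaterPhase ms S)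
    (hk : 2 ≤ k) {C : Config n k} (hC : C ∈ (Game.after ms).base ∪ (Game.after ms).reached)
    {β : List (Fin n)} (hβ : IsSchedule S.prot.δ C β) : (C.run β).Correct S.prot.δ := by
  obtain ⟨x, hx, γ, hγ, rfl⟩ := h.reach hC
  obtain ⟨δ, a, i, β', hinv, hδ, hsched, ha⟩ := h.finish
  have := isSchedule_append.2 ⟨hγ, hβ⟩
  rw [← Config.run_append]
  rw [hsched, hδ] at *
  exact hinv.correct_finish hk (ha x hx) this

theorem LaterPhase.terminatesCorrectly {ms : List (Move n k)} {S : Stage n k}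
    (h : LaterPhase ms S) (hk : 2 ≤ k) {C : Config n k} (hC : C ∈ (Game.after ms).base) :
    TerminatesCorrectly S.prot.δ C := by
  refine ⟨fun f hf => ?_, fun β hβ => h.correct hk (.inl hC) hβ⟩
  obtain ⟨x, hx, γ, hγ, rfl⟩ := h.reach (.inl hC)
  -- One step more than the weight bound of the completed protocol permits.
  have hs := hf (n * (2 * (S.bound + 2) + 1) + 1)
  have := h.weight_le (Reach.run ⟨x, _, hγ, rfl⟩ hs)
  rw [Config.weight_run, List.length_ofFn] at this
  omega

theorem not_violation_adversary (hk : 2 ≤ k) {ms : List (Move n k)}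
    (h : LegalPlay (adversary n k) ms) : ¬ (Game.after ms).Violation (adversary n k ms).δ := by
  rintro ⟨C, hC, hc⟩
  rcases firstPhase_or_laterPhase h with h' | h'
  · exact hc (h'.inv.correct hk (h'.reached ms List.prefix_rfl C (.inr hC)).1)
  · exact hc (h'.correct hk (.inr hC) (β := []) trivial)

/-! ### Chains of queries -/

/-- A property of configurations that is preserved by the queries of a chain holds along it. -/
theorem chain_induction {m : ℕ → Move n k} {T N : ℕ} {c : ℕ → Fin N} {Cf : ℕ → Config n k}
    {qf : ℕ → Fin n} (hm : ∀ t, T ≤ t → m t = .query (Cf t) (qf t))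
    (hc : ∀ t t', T ≤ t → t < t' → c t = c t' → (∀ u, t < u → u < t' → c u ≠ c t) →
      ∀ C q C' q', m t = .query C q → m t' = .query C' q' → C' = C.step q)
    {P : Config n k → Prop} {t : ℕ} (ht : T ≤ t) (h0 : P ((Cf t).step (qf t)))
    (hs : ∀ u, t < u → c u = c t → P (Cf u) → P ((Cf u).step (qf u))) :
    ∀ u, t < u → c u = c t → P (Cf u) := by
  intro u
  induction u using Nat.strong_induction_on with
  | _ u ih =>
    intro hu hcu
    -- The maximum is the last query of the chain before time `u`.
    have hex : ∃ v ∈ (Finset.Ico t u).filter (fun v => c v = c t), ∀ w ∈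
        (Finset.Ico t u).filter (fun v => c v = c t), w ≤ v :=
      Finset.exists_max_image _ id ⟨t, by simp [hu]⟩
    obtain ⟨v, hv, hmax⟩ := hex
    simp only [Finset.mem_filter, Finset.mem_Ico] at hv hmax
    obtain ⟨⟨htv, hvu⟩, hcv⟩ := hv
    rw [hc v u (ht.trans htv) hvu (hcv.trans hcu.symm) (fun w h1 h2 h3 => by
      have := hmax w ⟨⟨by omega, h2⟩, h3.trans hcv⟩
      omega) _ _ _ _ (hm v (ht.trans htv)) (hm u (by omega))]
    rcases htv.eq_or_lt with rfl | htv
    · exact h0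
    · exact hs v htv hcv (ih v hvu htv hcv)

/-- Finitely many chains cannot go on forever within configurations of bounded weight. -/
theorem not_finitelyManyChainsFrom_of_weight_le {m : ℕ → Move n k} {T T' W : ℕ}
    (hW : ∀ t, T' ≤ t → ∀ C q, m t = .query C q → C.weight ≤ W) :
    ¬ FinitelyManyChainsFrom T m := by
  rintro ⟨hq, N, c, hc⟩
  obtain ⟨C₀, q₀, -⟩ := hq T le_rfl
  have : Nonempty (Config n k) := ⟨C₀⟩
  have : Nonempty (Fin n) := ⟨q₀⟩
  choose! Cf qf hm using hq
  -- Some chain contains infinitely many queries, and the weight increases strictly along it.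
  obtain ⟨j, hj⟩ := Finite.exists_infinite_fiber fun t : Set.Ici (max T T') => c t
  have hj' := Set.infinite_coe_iff.1 hj
  have hlt : ∀ t ∈ (fun t : Set.Ici (max T T') => c t) ⁻¹' {j},
      ∀ u ∈ (fun t : Set.Ici (max T T') => c t) ⁻¹' {j}, t < u →
        (Cf t).weight < (Cf u).weight := by
    intro t ht u hu htu
    have hTt : T ≤ t := (le_max_left _ _).trans t.2
    refine chain_induction (P := fun C => (Cf t).weight < C.weight) hm hc hTt ?_ ?_ u htu
      (hu.trans ht.symm)
    · rw [Config.weight_step]; exact Nat.lt_succ_self _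
    · intro v _ _ hv
      rw [Config.weight_step]; exact hv.trans (Nat.lt_succ_self _)
  refine hj' (Set.Finite.of_finite_image (f := fun t => (Cf t).weight)
    ((Set.finite_Iic W).subset ?_) ?_)
  · rintro _ ⟨t, -, rfl⟩
    exact hW t ((le_max_right _ _).trans t.2) _ _ (hm t ((le_max_left _ _).trans t.2))
  · exact StrictMonoOn.injOn hlt

/-- The first `t` moves of an infinite sequence. -/
abbrev firstMoves (m : ℕ → Move n k) (t : ℕ) : List (Move n k) := List.ofFn fun i : Fin t => m i

theorem firstMoves_succ (m : ℕ → Move n k) (t : ℕ) :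
    firstMoves m (t + 1) = firstMoves m t ++ [m t] := by
  rw [firstMoves, List.ofFn_succ', List.concat_eq_append]
  rfl

theorem firstMoves_prefix (m : ℕ → Move n k) {s t : ℕ} (h : s ≤ t) :
    firstMoves m s <+: firstMoves m t := by
  induction h with
  | refl => exact List.prefix_rfl
  | step _ ih => rw [firstMoves_succ]; exact ih.trans (List.prefix_append _ _)

theorem mem_firstMoves (m : ℕ → Move n k) {s t : ℕ} (h : s < t) : m s ∈ firstMoves m t := by
  have := (firstMoves_prefix m (Nat.succ_le_of_lt h)).subset
  rw [firstMoves_succ] at this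
  exact this (by simp)

theorem legal_of_firstMoves {adv : Adversary n k} {m : ℕ → Move n k}
    (hl : ∀ t, LegalPlay adv (firstMoves m t)) (t : ℕ) :
    (Game.after (firstMoves m t)).Legal (adv (firstMoves m t)).δ (m t) := by
  have := hl (t + 1)
  rw [firstMoves_succ] at this
  exact (legalPlay_concat.1 this).2

/-- If a query changes the bound of the adversary, the process becomes decided. -/
theorem Stage.output_of_bound_ne {S : Stage n k} {C : Config n k} {q : Fin n}
    (h : (S.next (.query C q)).bound ≠ S.bound) :
    (C.step q).output (S.next (.query C q)).prot.δ q ≠ none := by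
  unfold Stage.next at h ⊢
  split at h
  · exact absurd rfl h
  · next hf =>
    rw [if_neg hf]
    simp only at h ⊢
    split at h
    · next hex =>
      rw [dif_pos hex]
      exact hex.choose_spec.2.2
    · exact absurd rfl h

/-- In the first phase every chain of queries is finite. -/
theorem not_finitelyManyChainsFrom_of_firstPhase {m : ℕ → Move n k}
    (hl : ∀ t, LegalPlay (adversary n k) (firstMoves m t)) (hcom : ∀ t, ¬ (m t).IsCommit) (T : ℕ) :
    ¬ FinitelyManyChainsFrom T m := by
  intro hchains
  obtain ⟨hq, N, c, hc⟩ := id hchains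
  obtain ⟨C₀, q₀, -⟩ := hq T le_rfl
  have : Nonempty (Config n k) := ⟨C₀⟩
  have : Nonempty (Fin n) := ⟨q₀⟩
  choose! Cf qf hm using hq
  set b : ℕ → ℕ := fun t => (stageAfter (firstMoves m t)).bound with hb
  have hphase : ∀ t, FirstPhase (firstMoves m t) (stageAfter (firstMoves m t)) := fun t =>
    FirstPhase.of_legalPlay (hl t) fun x hx => by
      obtain ⟨i, rfl⟩ := (List.mem_ofFn' _ _).1 hx
      exact hcom i
  have hsucc : ∀ t, stageAfter (firstMoves m (t + 1)) = (stageAfter (firstMoves m t)).next (m t) :=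
    fun t => by rw [firstMoves_succ, stageAfter_concat]
  -- a process that makes the bound increase does not take part in its chain any more
  have hhit : ∀ t u, T ≤ t → t < u → b (t + 1) ≠ b t → c u = c t → qf u ≠ qf t := by
    intro t u ht htu hbt hcu hqu
    have hdec : ((Cf t).step (qf t)).output (adversary n k (firstMoves m (t + 1))).δ (qf t) ≠
        none := by
      unfold adversary
      simp only [hb, hsucc] at hbt
      rw [hsucc]
      rw [hm t ht] at hbt ⊢
      exact Stage.output_of_bound_ne hbt
    have hstay : ∀ v, t < v → ((Cf t).step (qf t)).output (adversary n k (firstMoves m v)).δ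
        (qf t) ≠ none := by
      intro v hv
      have := coherent_adversary _ _ (hl v) (firstMoves_prefix m (Nat.succ_le_of_lt hv)) (m t)
        (mem_firstMoves m (Nat.lt_succ_self t))
      rw [hm t ht] at this
      simp only [Protocol.reply, Reply.reached.injEq, true_and] at this
      rwa [this]
    have hact : ∀ v, T ≤ v → (Cf v).Active (adversary n k (firstMoves m v)).δ (qf v) := by
      intro v hv
      have := legal_of_firstMoves hl v
      rw [hm v hv] at this
      exact this.2
    have hne : ∀ v, t < v → (Cf v).state (qf t) = ((Cf t).step (qf t)).state (qf t) →
        qf v ≠ qf t := by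
      intro v hv hst hqv
      have h1 := hact v (by omega)
      rw [hqv, Config.Active, Config.output, hst] at h1
      exact hstay v hv h1
    refine hne u htu ?_ hqu
    refine chain_induction (P := fun C => C.state (qf t) = ((Cf t).step (qf t)).state (qf t))
      hm hc ht rfl (fun v hv hcv hst => ?_) u htu hcu
    rw [Config.state_step_of_ne _ (hne v hv hst).symm, hst]
  -- Within one chain each process causes at most one increase, so the pairs of chain and process
  -- bound their number.
  have hfin : {t | T ≤ t ∧ b (t + 1) ≠ b t}.Finite := by
    refine Set.Finite.of_finite_image (f := fun t => (c t, qf t)) (Set.toFinite _) ?_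
    intro t ht u hu htu
    simp only [Prod.mk.injEq] at htu
    rcases lt_trichotomy t u with h | h | h
    · exact absurd htu.2.symm (hhit t u ht.1 h ht.2 htu.1.symm)
    · exact h
    · exact absurd htu.2 (hhit u t hu.1 h hu.2 htu.1)
  obtain ⟨M, hM⟩ := hfin.bddAbove
  have hconst : ∀ t, max T (M + 1) ≤ t → b t = b (max T (M + 1)) := by
    intro t ht
    induction t, ht using Nat.le_induction with
    | base => rfl
    | succ t ht ih =>
      rw [← ih]
      by_contra hne
      have := hM (show t ∈ {t | T ≤ t ∧ b (t + 1) ≠ b t} from ⟨(le_max_left _ _).trans ht, hne⟩)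
      have := (le_max_right T (M + 1)).trans ht
      omega
  refine not_finitelyManyChainsFrom_of_weight_le (T' := max T (M + 1))
    (W := n * (2 * (b (max T (M + 1)) + 1) + 1)) (fun t ht C q hCq => ?_) hchains
  have hleg := legal_of_firstMoves hl t
  rw [hCq] at hleg
  have := ((hphase t).reached _ List.prefix_rfl C hleg.1).2
  rw [← hconst t ht]
  exact Config.weight_le this

/-- The rules do not allow an infinite interaction with the adversary. -/
theorem not_infinite_by_rules {m : ℕ → Move n k}
    (hl : ∀ t, LegalPlay (adversary n k) (firstMoves m t)) :
    ¬ ((∀ T, ∃ t, T ≤ t ∧ (m t).IsCommit) ∨ ∃ T, FinitelyManyChainsFrom T m) := by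
  by_cases hcom : ∃ t, (m t).IsCommit
  · obtain ⟨t₀, ht₀⟩ := hcom
    have hex : ∀ t, t₀ < t → ∃ x ∈ firstMoves m t, x.IsCommit := fun t ht =>
      ⟨m t₀, mem_firstMoves m ht, ht₀⟩
    have hphase : ∀ t, t₀ < t → LaterPhase (firstMoves m t) (stageAfter (firstMoves m (t₀ + 1))) := by
      intro t ht
      rw [← adversary_eq_of_commit (hl t) (firstMoves_prefix m (Nat.succ_le_of_lt ht))
        (hex (t₀ + 1) (Nat.lt_succ_self _))]
      exact LaterPhase.of_legalPlay (hl t) (hex t ht)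
    set S := stageAfter (firstMoves m (t₀ + 1))
    rintro (hinf | ⟨T, hT⟩)
    -- Every commitment lengthens the schedule, whose length is bounded by the weight of a
    -- configuration of the completed protocol.
    · set L : ℕ → ℕ := fun t => (Game.after (firstMoves m t)).sched.length with hL
      have hLe : ∀ t, t₀ < t → L t ≤ n * (2 * (S.bound + 2) + 1) := by
        intro t ht
        have h := hphase t ht
        obtain ⟨x, hx⟩ := h.inits_nonempty
        have := h.weight_le ⟨x, _, h.schedule x hx, rfl⟩
        rw [Config.weight_run] at this
        exact (Nat.le_add_left _ _).trans this
      have hstep : ∀ t, L t ≤ L (t + 1) ∧ ((m t).IsCommit → L t < L (t + 1)) := by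
        intro t
        have hleg := legal_of_firstMoves hl t
        simp only [hL, firstMoves_succ, Game.after_concat]
        cases hmt : m t with
        | query C q => exact ⟨le_rfl, fun h => h.elim⟩
        | output C Q y => exact ⟨le_rfl, fun h => h.elim⟩
        | commit x β =>
          rw [hmt] at hleg
          have := List.length_pos_iff.2 hleg.2.1
          simp only [Game.next, List.length_append]
          omega
      have hmono : Monotone L := monotone_nat_of_le_succ fun t => (hstep t).1
      have hunb : ∀ N, ∃ t, N ≤ L t := by
        intro N
        induction N with
        | zero => exact ⟨0, Nat.zero_le _⟩
        | succ N ih =>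
          obtain ⟨t, ht⟩ := ih
          obtain ⟨u, hu, hc⟩ := hinf t
          have h1 := hmono hu
          have h2 := (hstep u).2 hc
          exact ⟨u + 1, by omega⟩
      obtain ⟨t, ht⟩ := hunb (n * (2 * (S.bound + 2) + 1) + 1)
      have h1 := hLe (max t (t₀ + 1)) (by omega)
      have h2 := hmono (le_max_left t (t₀ + 1))
      omega
    · refine not_finitelyManyChainsFrom_of_weight_le (T' := t₀ + 1)
        (W := n * (2 * (S.bound + 2) + 1)) (fun t ht C q hCq => ?_) hT
      have hleg := legal_of_firstMoves hl t
      rw [hCq] at hleg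
      have h := hphase t ht
      obtain ⟨x, hx, γ, hγ, rfl⟩ := h.reach hleg.1
      exact h.weight_le ⟨x, _, hγ, rfl⟩
  · rintro (hinf | ⟨T, hT⟩)
    · obtain ⟨t, -, ht⟩ := hinf 0
      exact hcom ⟨t, ht⟩
    · exact not_finitelyManyChainsFrom_of_firstPhase hl (fun t ht => hcom ⟨t, ht⟩) T hT

/-! ### Provers against the adversary -/

theorem map_fst_transcript (P : Prover n k) (adv : Adversary n k) (t : ℕ) :
    (transcript P adv t).map Prod.fst = firstMoves (moveAt P adv) t := by
  induction t with
  | zero => simp [transcript]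
  | succ t ih => rw [firstMoves_succ, ← ih]; simp [transcript, moveAt]

theorem legalPlay_firstMoves {P : Prover n k} {adv : Adversary n k} {t : ℕ}
    (h : ∀ s < t, LegalAt P adv s) : LegalPlay adv (firstMoves (moveAt P adv) t) := by
  induction t with
  | zero =>
    intro ms' m h'
    simp [firstMoves] at h'
  | succ t ih =>
    rw [firstMoves_succ]
    refine legalPlay_concat.2 ⟨ih fun s hs => h s (by omega), ?_⟩
    have := h t (by omega)
    unfold LegalAt gameAt deltaAt at this
    rwa [map_fst_transcript] at this

theorem not_violationAt (hk : 2 ≤ k) {P : Prover n k} {t : ℕ}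
    (h : ∀ s < t, LegalAt P (adversary n k) s) : ¬ ViolationAt P (adversary n k) t := by
  unfold ViolationAt gameAt deltaAt
  rw [map_fst_transcript]
  exact not_violation_adversary hk (legalPlay_firstMoves h)

theorem not_infiniteByRules {P : Prover n k} (h : ∀ t, LegalAt P (adversary n k) t) :
    ¬ InfiniteByRules P (adversary n k) :=
  not_infinite_by_rules fun _ => legalPlay_firstMoves fun s _ => h s

/-- Every prover that obeys the rules loses. -/
theorem loses_of_obeysRules (hk : 2 ≤ k) {P : Prover n k} (hP : ObeysRules P (adversary n k)) :
    Loses P (adversary n k) := by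
  have hleg : ∀ t, (∀ s < t, ¬ LostAt P (adversary n k) s) →
      ∀ s < t, LegalAt P (adversary n k) s := by
    intro t ht s
    -- Legality is promised only while there is no violation, and violations are excluded only after
    -- legal moves; hence the strong induction.
    induction s using Nat.strong_induction_on with
    | _ s ih =>
      intro hs
      refine hP.1 s fun u hu => ⟨ht u (by omega), ?_⟩
      exact not_violationAt hk fun v hv => ih v (by omega) (by omega)
  by_cases hlost : ∃ t, LostAt P (adversary n k) t
  · classical
    have hmin := fun s (hs : s < Nat.find hlost) => Nat.find_min hlost hs
    have hl := hleg _ hmin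
    exact ⟨Nat.find hlost, hl, fun s hs => not_violationAt hk fun u hu => hl u (by omega),
      Nat.find_spec hlost⟩
  · have hl : ∀ t, LegalAt P (adversary n k) t := fun t =>
      hleg (t + 1) (fun s _ h => hlost ⟨s, h⟩) t (Nat.lt_succ_self t)
    exact absurd (hP.2 fun t => ⟨fun h => hlost ⟨t, h⟩, not_violationAt hk fun s _ => hl s⟩)
      (not_infiniteByRules hl)

/-! ### From the adaptive adversary to a single protocol -/

/-- The interaction with a fixed protocol that gives the same replies is the same. -/
theorem transcript_eq {P : Prover n k} {adv : Adversary n k} {R : Protocol n k} {t : ℕ}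
    (h : ∀ s < t, R.reply (moveAt P adv s) =
      (adv (firstMoves (moveAt P adv) (s + 1))).reply (moveAt P adv s)) :
    transcript P R.toAdversary t = transcript P adv t := by
  induction t with
  | zero => rfl
  | succ t ih =>
    have h1 := h t (Nat.lt_succ_self t)
    rw [firstMoves_succ, ← map_fst_transcript] at h1
    unfold moveAt at h1
    rw [transcript, transcript, ih fun s hs => h s (by omega), Protocol.toAdversary, h1]

/-- A finite schedule consults the decision map in finitely many states only. -/
theorem eventually_isSchedule_iff {l : Filter ℕ} {R : ℕ → DecisionMap n k} {δ : DecisionMap n k}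
    (h : ∀ s, ∀ᶠ t in l, R t s = δ s) (C : Config n k) (β : List (Fin n)) :
    ∀ᶠ t in l, (IsSchedule (R t) C β ↔ IsSchedule δ C β) := by
  induction β generalizing C with
  | nil => exact .of_forall fun t => Iff.rfl
  | cons q β ih =>
    filter_upwards [h (C.state q), ih (C.step q)] with t h1 h2
    simp only [IsSchedule, Config.Active, Config.output, h2, State.output_congr h1]

theorem eventually_isOutputWitness_iff {l : Filter ℕ} {R : ℕ → DecisionMap n k}
    {δ : DecisionMap n k} (h : ∀ s, ∀ᶠ t in l, R t s = δ s) (C : Config n k) (Q : Finset (Fin n))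
    (y : Fin (k + 1)) (β : List (Fin n)) :
    ∀ᶠ t in l, (IsOutputWitness (R t) C Q y β ↔ IsOutputWitness δ C Q y β) := by
  filter_upwards [eventually_isSchedule_iff h C β,
    Filter.eventually_all.2 fun q => h ((C.run β).state q)] with t h1 h2
  simp only [IsOutputWitness, Config.output, h1, fun q => State.output_congr (h2 q)]

open Filter in
/-- A sequence of protocols has a limit, which agrees with all replies and decisions that are
eventually constant. -/
theorem exists_limit (R : ℕ → Protocol n k) : ∃ R' : Protocol n k,
    (∀ m r, (∀ᶠ t in atTop, (R t).reply m = r) → R'.reply m = r) ∧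
      ∀ s o, (∀ᶠ t in atTop, (R t).δ s = o) → R'.δ s = o := by
  classical
  -- Decisions take finitely many values, so the maps converge pointwise along any ultrafilter; a
  -- nonprincipal one keeps whatever is eventually constant.
  set U : Ultrafilter ℕ := hyperfilter ℕ
  have hU : (U : Filter ℕ) ≤ atTop := Nat.hyperfilter_le_atTop
  have hδ : ∀ s, ∃ o, ∀ᶠ t in (U : Filter ℕ), (R t).δ s = o := by
    intro s
    have huniv : (⋃ o ∈ (Set.univ : Set (Option (Fin (k + 1)))), {t | (R t).δ s = o}) = Set.univ := by
      ext t; simp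
    have := (Ultrafilter.finite_biUnion_mem_iff (f := U) Set.finite_univ).1
      (huniv ▸ Filter.univ_mem)
    obtain ⟨o, -, ho⟩ := this
    exact ⟨o, ho⟩
  choose δ hδ using hδ
  have huniq : ∀ {α : Type} {f : ℕ → α} {a b : α}, (∀ᶠ t in (U : Filter ℕ), f t = a) →
      (∀ᶠ t in (U : Filter ℕ), f t = b) → a = b := by
    intro α f a b ha hb
    obtain ⟨t, h1, h2⟩ := (ha.and hb).exists
    exact h1.symm.trans h2
  have hans : ∀ C Q y, ∃ a : Option (List (Fin n)),
      (∀ β, a = some β → IsOutputWitness δ C Q y β) ∧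
      (a = none → ∀ β, ¬ IsOutputWitness δ C Q y β) ∧
      ∀ a', (∀ᶠ t in (U : Filter ℕ), (R t).answer C Q y = a') → a = a' := by
    intro C Q y
    -- A limiting answer is correct for the limit map, because each single schedule is eventually
    -- judged alike. Without a limiting answer nothing is prescribed, and any correct answer will
    -- do.
    by_cases hex : ∃ a', ∀ᶠ t in (U : Filter ℕ), (R t).answer C Q y = a'
    · obtain ⟨a, ha⟩ := hex
      refine ⟨a, ?_, ?_, fun a' ha' => huniq ha ha'⟩
      · rintro β rfl
        obtain ⟨t, h1, h2⟩ := (ha.and (eventually_isOutputWitness_iff hδ C Q y β)).exists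
        exact h2.1 ((R t).answer_some _ _ _ _ h1)
      · rintro rfl β hβ
        obtain ⟨t, h1, h2⟩ := (ha.and (eventually_isOutputWitness_iff hδ C Q y β)).exists
        exact (R t).answer_none _ _ _ h1 β (h2.2 hβ)
    · by_cases hw : ∃ β, IsOutputWitness δ C Q y β
      · obtain ⟨β, hβ⟩ := hw
        refine ⟨some β, ?_, by simp, fun a' ha' => absurd ⟨a', ha'⟩ hex⟩
        rintro _ ⟨⟩
        exact hβ
      · exact ⟨none, by simp, fun _ β hβ => hw ⟨β, hβ⟩, fun a' ha' => absurd ⟨a', ha'⟩ hex⟩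
  choose ans h1 h2 h3 using hans
  refine ⟨⟨δ, ans, h1, h2⟩, fun m r hr => ?_, fun s o ho => huniq (hδ s) (hU ho)⟩
  have hr' : ∀ᶠ t in (U : Filter ℕ), (R t).reply m = r := hU hr
  cases m with
  | query C q =>
    obtain ⟨t, h4, h5⟩ := (hr'.and (hδ ((C.step q).state q))).exists
    rw [← h4]
    exact congrArg _ (State.output_congr h5).symm
  | output C Q y =>
    obtain ⟨t, h4⟩ := hr'.exists
    rw [← h4]
    refine congrArg Reply.answer (h3 C Q y _ ?_)
    filter_upwards [hr'] with u hu
    simpa [Protocol.reply] using hu.trans h4.symm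
  | commit x β =>
    obtain ⟨t, h4⟩ := hr'.exists
    exact h4

theorem Config.correct_congr {δ δ' : DecisionMap n k} {C : Config n k}
    (h : ∀ p, C.output δ' p = C.output δ p) : C.Correct δ' ↔ C.Correct δ := by
  simp only [Config.Correct, h]

/-- No prover wins against every protocol. -/
theorem not_extensionBasedProof (hk : 2 ≤ k) : ¬ ExtensionBasedProof n k := by
  rintro ⟨P, hP⟩
  set adv := adversary n k with hadv
  set m := moveAt P adv with hm
  -- If the interaction stops, the protocol in use at that time reproduces all replies by coherence.
  -- If it never stops, the protocols may change forever, and their limit is used.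
  by_cases hend : ∃ t, ¬ (LegalAt P adv t ∧ ¬ LostAt P adv t)
  · classical
    obtain ⟨t, ht, hmin⟩ : ∃ t, ¬ (LegalAt P adv t ∧ ¬ LostAt P adv t) ∧
        ∀ s < t, LegalAt P adv s ∧ ¬ LostAt P adv s :=
      ⟨Nat.find hend, Nat.find_spec hend, fun s hs => not_not.1 (Nat.find_min hend hs)⟩
    have hleg : ∀ s ≤ t, LegalPlay adv (firstMoves m s) := fun s hs =>
      legalPlay_firstMoves fun u hu => (hmin u (by omega)).1
    set R := adv (firstMoves m t) with hR
    have htr : ∀ s ≤ t, transcript P R.toAdversary s = transcript P adv s := fun s hs =>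
      transcript_eq fun u hu => coherent_adversary _ _ (hleg t le_rfl)
        (firstMoves_prefix m (by omega)) _ (mem_firstMoves m (Nat.lt_succ_self u))
    have hnot : ¬ (LegalAt P R.toAdversary t ∧ ¬ LostAt P R.toAdversary t) := by
      unfold LegalAt LostAt gameAt deltaAt moveAt at ht ⊢
      rw [htr t le_rfl]
      rwa [map_fst_transcript] at ht ⊢
    rcases hP R with ⟨s, hs, hviol⟩ | ⟨hall, -⟩
    · have hst : s ≤ t := by
        by_contra hlt
        exact hnot (hs t (by omega))
      unfold ViolationAt gameAt deltaAt at hviol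
      rw [htr s hst, map_fst_transcript] at hviol
      obtain ⟨C, hC, hc⟩ := hviol
      -- The fixed protocol has the same outputs in `C` as the adversary had at time `s`, so a
      -- violation would be one against the adversary.
      refine not_violation_adversary hk (hleg s hst) ⟨C, hC, fun hcor => hc ?_⟩
      exact (Config.correct_congr
        (output_stable (hleg t le_rfl) (firstMoves_prefix m hst) (.inr hC))).2 hcor
    · exact hnot (hall t)
  · have hall : ∀ t, LegalAt P adv t ∧ ¬ LostAt P adv t := fun t => by
      by_contra h
      exact hend ⟨t, h⟩
    have hleg : ∀ t, LegalPlay adv (firstMoves m t) := fun t =>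
      legalPlay_firstMoves fun s _ => (hall s).1
    obtain ⟨R, hR, hδ⟩ := exists_limit fun t => adv (firstMoves m t)
    have htr : ∀ t, transcript P R.toAdversary t = transcript P adv t := fun t =>
      transcript_eq fun u hu => hR _ _ (by
        filter_upwards [Filter.eventually_ge_atTop (u + 1)] with v hv
        exact coherent_adversary _ _ (hleg v) (firstMoves_prefix m hv) _
          (mem_firstMoves m (Nat.lt_succ_self u)))
    rcases hP R with ⟨s, hs, hviol⟩ | ⟨-, hinf⟩
    · unfold ViolationAt gameAt deltaAt at hviol
      rw [htr s, map_fst_transcript] at hviol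
      obtain ⟨C, hC, hc⟩ := hviol
      refine not_violation_adversary hk (hleg s) ⟨C, hC, fun hcor => hc ?_⟩
      refine (Config.correct_congr fun p => ?_).2 hcor
      obtain ⟨v, hv⟩ := (Filter.eventually_ge_atTop s).exists
      cases hst : C.state p with
      | scanned i V =>
        unfold Config.output
        rw [hst]
        refine hδ _ _ ?_
        filter_upwards [Filter.eventually_ge_atTop s] with v hv
        have := output_stable (hleg v) (firstMoves_prefix m hv) (.inr hC) p
        unfold Config.output at this
        rwa [hst] at this
      | _ => unfold Config.output; rw [hst]; rfl
    · have hmove : moveAt P R.toAdversary = m := by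
        funext t
        simp only [hm, moveAt, htr]
      refine not_infiniteByRules (fun t => (hall t).1) ?_
      unfold InfiniteByRules at hinf ⊢
      rwa [hmove] at hinf

end NIS

end

theorem mainTheorem1 (n k : ℕ) (hk : 2 ≤ k) (hn : k < n) :
    ¬ NIS.ExtensionBasedProof n k ∧
    ∃ adv : NIS.Adversary n k,
      -- the protocol under construction always agrees with all replies given so far
      NIS.Coherent adv ∧
      -- phase 1: no violation of agreement or validity is ever reached
      (∀ ms, NIS.LegalPlay adv ms → (∀ m ∈ ms, ¬ m.IsCommit) →
        ¬ (NIS.Game.after ms).Violation (adv ms).δ) ∧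
      -- phase 1: every chain of queries is finite
      (∀ m : ℕ → NIS.Move n k,
        (∀ t, NIS.LegalPlay adv (List.ofFn fun i : Fin t => m i)) → (∀ t, ¬ (m t).IsCommit) →
          ∀ T, ¬ NIS.FinitelyManyChainsFrom T m) ∧
      -- from phase 2 on: the protocol is fixed, and every continuation terminates correctly
      (∀ ms, NIS.LegalPlay adv ms → (∃ m ∈ ms, m.IsCommit) →
        (∀ ms', NIS.LegalPlay adv ms' → ms <+: ms' → adv ms' = adv ms) ∧
        ∀ C ∈ (NIS.Game.after ms).base, NIS.TerminatesCorrectly (adv ms).δ C) ∧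
      -- every prover that obeys the rules loses
      ∀ P : NIS.Prover n k, NIS.ObeysRules P adv → NIS.Loses P adv :=
  ⟨NIS.not_extensionBasedProof hk, NIS.adversary n k, NIS.coherent_adversary,
    fun _ h _ => NIS.not_violation_adversary hk h,
    fun _ hl hc T => NIS.not_finitelyManyChainsFrom_of_firstPhase hl hc T,
    fun _ h hc => ⟨fun _ h' hp => congrArg NIS.Stage.prot (NIS.adversary_eq_of_commit h' hp hc),
      fun _ hC => (NIS.LaterPhase.of_legalPlay h hc).terminatesCorrectly hk hC⟩,
    fun _ hP => NIS.loses_of_obeysRules hk hP⟩
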